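/- Let $\mathbb P_X$ be a probability distribution on $[0,1]$ with a Lebesgue density, let $k\in\{0,1,2,\dots\}$, $\sigma>0$ and $f_0\in C^k[0,1]$, and let $\mathbb P_0^{(n)}$ be the law of $n$ independent observations $(X_i,Y_i)$ with $X_i\sim\mathbb P_X$, $Y_i=f_0(X_i)+\varepsilon_i$, where $\varepsilon_i\sim N(0,\sigma^2)$ is independent of $X_i$. Let $K\in C^{2k}([0,1],[0,1])$ be a kernel, meaning that $\partial_x^j\partial_{x'}^jK$ exists and is continuous on $[0,1]^2$ for all $0\le j\le k$, with a Mercer expansion $K(x,x')=\sum_{i\ge1}\mu_i\phi_i(x)\phi_i(x')$ for all $x,x'\in[0,1]$, where $\mu_1\ge\mu_2\ge\cdots>0$, $\mu_i\to0$, are the eigenvalues of the integral operator of $K$ on $L^2(\mathbb P_X)$, and the eigenfunctions $(\phi_i)_{i\ge1}$ form an orthonormal basis of $L^2(\mathbb P_X)$. Assume (A): there is $C>0$ with $\|\phi_i^{(k)}\|_\infty\le C\,i^k$ for all $i\ge1$. Let $\lambda=\lambda_n>0$, and for $m\in\{0,k\}$ put $$\tilde\kappa_m^2=\sup_{x\in[0,1]}\sum_{i\ge1}\frac{\mu_i}{\lambda_n+\mu_i}\,\phi_i^{(m)}(x)^2,\qquad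 \tilde\kappa^2=\tilde\kappa_0^2 .$$ For the Gaussian process prior $f\sim\mathrm{GP}(0,\sigma^2(n\lambda_n)^{-1}K)$, the plug-in posterior variance of $f^{(k)}$ is $\tilde V_n^k(x)=\tilde V_n^k(x,x)$, where $$\tilde V_n^k(x,x')=\sigma^2(n\lambda_n)^{-1}\Big\{\partial_x^k\partial_{x'}^kK(x,x')-\big(\partial_x^kK(x,X_i)\big)_{i}^{T}\,[K(X,X)+n\lambda_nI_n]^{-1}\,\big(\partial_{x'}^kK(X_i,x')\big)_{i}\Big\}$$ and $K(X,X)=(K(X_i,X_j))_{i,j=1}^n$. If $\lambda_n$ is chosen such that $\tilde\kappa^2=o(\sqrt{n/\log n})$ as $n\to\infty$, then for all sufficiently large $n$, with $\mathbb P_0^{(n)}$-probability at least $1-n^{-10}$, $$\|\tilde V_n^k\|_\infty=\sup_{x\in[0,1]}|\tilde V_n^k(x)|\le\frac{2\sigma^2\tilde\kappa_k^2}{n}.$$ -/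

import Mathlib

open Set Filter Topology MeasureTheory ProbabilityTheory

noncomputable section

namespace PlugInGP

/-- The covariate space `[0,1]`. Functions on `[0,1]` are represented by functions on `ℝ`
of which only the values on `[0,1]` matter. -/
abbrev I01 : Set ℝ := Set.Icc (0 : ℝ) 1

/-- `∂ₓᵃ ∂ₓ'ᵇ K (x, x')`, with one-sided derivatives at the end points of `[0,1]`. -/
def mixedDeriv (a b : ℕ) (K : ℝ → ℝ → ℝ) (x x' : ℝ) : ℝ :=
  iteratedDerivWithin a (fun s => iteratedDerivWithin b (fun t => K s t) I01 x') I01 x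

/-- `f` is `j` times differentiable on `[0,1]`. -/
def TimesDiff (j : ℕ) (f : ℝ → ℝ) : Prop :=
  ∀ i < j, DifferentiableOn ℝ (iteratedDerivWithin i f I01) I01

/-- `K ∈ C^{2k}([0,1],[0,1])`: for every `j ≤ k` the mixed derivative `∂ₓʲ ∂ₓ'ʲ K` exists and
is jointly continuous on `[0,1]²` (for `j = 0`: `K` is continuous). -/
def IsC2k (k : ℕ) (K : ℝ → ℝ → ℝ) : Prop :=
  ∀ j ≤ k,
    (∀ x ∈ I01, TimesDiff j (fun x' => K x x')) ∧
    (∀ x' ∈ I01, TimesDiff j (fun x => iteratedDerivWithin j (fun t => K x t) I01 x')) ∧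
    ContinuousOn (fun p : ℝ × ℝ => mixedDeriv j j K p.1 p.2) (I01 ×ˢ I01)

/-- `(μ i, φ i)`, `i = 0, 1, 2, …`, is the Mercer eigensystem of `K` relative to the covariate
law `PX`; the pair with index `i` is the `(i+1)`-st one in the usual enumeration from `1`.
The expansion makes `K` symmetric and positive definite on `[0,1]`. -/
structure IsMercerSystem (PX : Measure ℝ) (K : ℝ → ℝ → ℝ) (μ : ℕ → ℝ) (φ : ℕ → ℝ → ℝ) :
    Prop where
  pos : ∀ i, 0 < μ i
  antitone : Antitone μ
  tendsto_zero : Tendsto μ atTop (𝓝 0)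
  basis : ∃ b : HilbertBasis ℕ ℝ (Lp ℝ 2 PX), ∀ i, (b i : ℝ → ℝ) =ᵐ[PX] φ i
  eigen : ∀ i, ∀ x ∈ I01, ∫ y, K x y * φ i y ∂PX = μ i * φ i x
  expansion : ∀ x ∈ I01, ∀ x' ∈ I01, HasSum (fun i => μ i * φ i x * φ i x') (K x x')

/-- Assumption (A): `‖φ_i^{(k)}‖_∞ ≤ C i^k` for all `i ≥ 1` (the index is shifted by one). -/
def AssumptionA (k : ℕ) (φ : ℕ → ℝ → ℝ) : Prop :=
  ∃ C : ℝ, 0 < C ∧ ∀ i : ℕ, ∀ x ∈ I01,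
    |iteratedDerivWithin k (φ i) I01 x| ≤ C * ((i : ℝ) + 1) ^ k

/-- The `m`-th order effective dimension
`κ̃_m² = sup_{x ∈ [0,1]} ∑_i μ_i / (λ + μ_i) φ_i^{(m)}(x)²`. -/
def kappaSq (μ : ℕ → ℝ) (φ : ℕ → ℝ → ℝ) (lam : ℝ) (m : ℕ) : ℝ :=
  ⨆ x : I01, ∑' i, μ i / (lam + μ i) * (iteratedDerivWithin m (φ i) I01 (x : ℝ)) ^ 2

/-- The plug-in posterior covariance `Ṽ_n^k(x, x')` of the `k`-th derivative at the design
`X = (X_1, …, X_n)`: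
`σ² (nλ)⁻¹ {K_kk(x,x') - K_k0(x,X) [K(X,X) + nλ I]⁻¹ K_0k(X,x')}`. -/
def plugInCov (k : ℕ) (K : ℝ → ℝ → ℝ) (σ lam : ℝ) {n : ℕ} (X : Fin n → ℝ) (x x' : ℝ) : ℝ :=
  let G : Matrix (Fin n) (Fin n) ℝ :=
    Matrix.of (fun i j => K (X i) (X j)) + ((n : ℝ) * lam) • (1 : Matrix (Fin n) (Fin n) ℝ)
  σ ^ 2 * ((n : ℝ) * lam)⁻¹ *
    (mixedDeriv k k K x x' -
      (fun i => mixedDeriv k 0 K x (X i)) ⬝ᵥ (G⁻¹.mulVec (fun i => mixedDeriv 0 k K (X i) x')))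

/-- The law `P₀` of one observation `(X, Y)` with `X ∼ PX`, `Y = f₀(X) + ε` and
`ε ∼ N(0, σ²)` independent of `X`. -/
def obsLaw (PX : Measure ℝ) (f₀ : ℝ → ℝ) (σ : ℝ) : Measure (ℝ × ℝ) :=
  (PX.prod (gaussianReal 0 (Real.toNNReal (σ ^ 2)))).map (fun p => (p.1, f₀ p.1 + p.2))

/-- The law `P₀^{(n)}` of `n` independent observations. -/
def dataLaw (PX : Measure ℝ) (f₀ : ℝ → ℝ) (σ : ℝ) (n : ℕ) : Measure (Fin n → ℝ × ℝ) :=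
  Measure.pi (fun _ => obsLaw PX f₀ σ)

end PlugInGP

end

/-! In the Mercer feature space ℓ², let `ψ x = (√μ_i φ_i(x))_i`, so that `K x y = ⟨ψ x, ψ y⟩`, and
let `g = ∂^k ψ(x)`. The posterior variance is `σ²(nλ)⁻¹⟨g, r⟩`, where `r` is the residual of the
ridge regression of `g` on the vectors `ψ (X_a)`, that is `r = λ(Σ̂ + λ)⁻¹g` with `Σ̂` the empirical
second moment operator. The population operator `Σ` is diagonal with entries `μ_i`, and `⟨g, (Σ +
λ)⁻¹g⟩ = ∑ μ_i/(λ + μ_i) φ_i^{(k)}(x)² ≤ κ̃_k²`. It therefore suffices to replace `Σ̂ + λ` by `Σ +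
λ` at the cost of a factor 2 (`ridge_form_le`), which works once the whitened difference `(Σ +
λ)^{-1/2}(Σ̂ - Σ)(Σ + λ)^{-1/2}` has Hilbert–Schmidt norm at most 1/2.

That difference is a centred average of i.i.d. rank-one tensors, each of norm at most `κ̃²`. A
dimension-free Hoeffding inequality (`measureReal_norm_sum_centered_ge_le`) bounds the failure
probability by `2 exp(-n/(32 κ̃⁴))`, and `κ̃² = o(√(n/log n))` makes this smaller than `n⁻¹⁰`. The
event does not involve `x`, so the bound is uniform in `x`.

Smoothness of `K` must also be transferred to `ψ` (`exists_featureMap_derivatives`): difference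
quotients of `ψ` are Cauchy because their inner products are values of the jointly continuous mixed
derivative at intermediate points. -/

namespace PlugInGP

/-! ### Hoeffding's inequality in Hilbert space -/

/-- The power series `∑ uⁿ/(2n)!` has nonnegative coefficients, and each `uⁿ` is convex on the
half-line. -/
theorem convexOn_cosh_sqrt : ConvexOn ℝ (Ici (0 : ℝ)) (fun u => Real.cosh (Real.sqrt u)) := by
  have hs : ∀ u : ℝ, 0 ≤ u →
      HasSum (fun n : ℕ => u ^ n / ((2 * n).factorial : ℝ)) (Real.cosh (Real.sqrt u)) := by
    intro u hu
    have := Real.hasSum_cosh (Real.sqrt u)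
    simpa only [pow_mul, Real.sq_sqrt hu] using this
  refine ⟨convex_Ici 0, fun x hx y hy a b ha hb hab => ?_⟩
  have hx' : (0 : ℝ) ≤ x := hx
  have hy' : (0 : ℝ) ≤ y := hy
  have hz : 0 ≤ a * x + b * y := by positivity
  refine hasSum_le (fun n => ?_) (hs _ hz) (((hs x hx).mul_left a).add ((hs y hy).mul_left b))
  have := (convexOn_pow n).2 hx hy ha hb hab
  simp only [smul_eq_mul] at this
  rw [← mul_div_assoc, ← mul_div_assoc, ← add_div]
  exact div_le_div_of_nonneg_right this (by positivity)

section Hilbert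

variable {E : Type*} [NormedAddCommGroup E] [InnerProductSpace ℝ E]

/-- With `a = ‖s‖` and `b = ‖d‖`, the squares `‖s ± d‖²` are convex combinations of `(a + b)²` and
`(a - b)²` with complementary weights. Convexity of `cosh ∘ √` bounds the sum by its value in the
collinear case, `cosh (a + b) + cosh (a - b)`. -/
theorem cosh_norm_add_add_cosh_norm_sub_le (s d : E) :
    Real.cosh ‖s + d‖ + Real.cosh ‖s - d‖ ≤ 2 * (Real.cosh ‖s‖ * Real.cosh ‖d‖) := by
  set a := ‖s‖ with ha
  set b := ‖d‖ with hb
  have ha0 : 0 ≤ a := norm_nonneg _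
  have hb0 : 0 ≤ b := norm_nonneg _
  have e1 : ‖s + d‖ ^ 2 = a ^ 2 + 2 * inner ℝ s d + b ^ 2 := norm_add_sq_real s d
  have e2 : ‖s - d‖ ^ 2 = a ^ 2 - 2 * inner ℝ s d + b ^ 2 := norm_sub_sq_real s d
  have hc := abs_le.1 (abs_real_inner_le_norm s d)
  rw [← ha, ← hb] at hc
  have key : ∀ θ : ℝ, 0 ≤ θ → θ ≤ 1 →
      Real.cosh (Real.sqrt (θ * (a + b) ^ 2 + (1 - θ) * (a - b) ^ 2)) ≤
        θ * Real.cosh (a + b) + (1 - θ) * Real.cosh (a - b) := by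
    intro θ h0 h1
    have := convexOn_cosh_sqrt.2 (mem_Ici.2 (sq_nonneg (a + b))) (mem_Ici.2 (sq_nonneg (a - b)))
      h0 (sub_nonneg.2 h1) (by ring)
    simpa only [smul_eq_mul, Real.sqrt_sq_eq_abs, Real.cosh_abs] using this
  obtain ⟨θ, h0, h1, hθ⟩ : ∃ θ : ℝ, 0 ≤ θ ∧ θ ≤ 1 ∧ (2 * θ - 1) * (a * b) = inner ℝ s d := by
    rcases eq_or_ne (a * b) 0 with h | h
    · refine ⟨0, le_rfl, zero_le_one, ?_⟩
      rw [h] at hc ⊢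
      linarith
    · have hp : 0 < a * b := lt_of_le_of_ne (by positivity) h.symm
      refine ⟨(inner ℝ s d / (a * b) + 1) / 2, ?_, ?_, ?_⟩
      · have : -1 ≤ inner ℝ s d / (a * b) := by rw [le_div_iff₀ hp]; linarith
        linarith
      · have : inner ℝ s d / (a * b) ≤ 1 := by rw [div_le_iff₀ hp]; linarith
        linarith
      · have : 2 * ((inner ℝ s d / (a * b) + 1) / 2) - 1 = inner ℝ s d / (a * b) := by ring
        rw [this, div_mul_cancel₀ _ h]
  have k1 := key θ h0 h1
  have k2 := key (1 - θ) (by linarith) (by linarith)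
  have f1 : θ * (a + b) ^ 2 + (1 - θ) * (a - b) ^ 2 = ‖s + d‖ ^ 2 := by
    rw [e1, ← hθ]; ring
  have f2 : (1 - θ) * (a + b) ^ 2 + (1 - (1 - θ)) * (a - b) ^ 2 = ‖s - d‖ ^ 2 := by
    rw [e2, ← hθ]; ring
  rw [f1, Real.sqrt_sq (norm_nonneg _)] at k1
  rw [f2, Real.sqrt_sq (norm_nonneg _)] at k2
  have := Real.cosh_add a b
  have := Real.cosh_sub a b
  nlinarith

theorem convexOn_cosh_norm : ConvexOn ℝ (univ : Set E) (fun x => Real.cosh ‖x‖) := by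
  have hc : ConvexOn ℝ (univ : Set ℝ) Real.cosh := by
    have h1 : ConvexOn ℝ univ (fun x : ℝ => Real.exp (-x)) :=
      convexOn_exp.comp_linearMap (-LinearMap.id)
    have := (convexOn_exp.add h1).smul (c := (1 / 2 : ℝ)) (by norm_num)
    refine this.congr fun x _ => ?_
    simp only [Pi.add_apply, smul_eq_mul, Real.cosh_eq]
    ring
  refine ⟨convex_univ, fun x _ y _ a b ha hb hab => ?_⟩
  refine le_trans ?_ (hc.2 (mem_univ ‖x‖) (mem_univ ‖y‖) ha hb hab)
  rw [Real.cosh_le_cosh]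
  refine abs_le_abs_of_nonneg (norm_nonneg _) ((norm_add_le _ _).trans ?_)
  simp [norm_smul, abs_of_nonneg ha, abs_of_nonneg hb]

omit [InnerProductSpace ℝ E] in
theorem integrable_cosh_norm_of_bound {β : Type*} [MeasurableSpace β] (τ : Measure β)
    [IsFiniteMeasure τ] {f : β → E} (hf : StronglyMeasurable f) {B : ℝ} (hB : ∀ x, ‖f x‖ ≤ B) :
    Integrable (fun x => Real.cosh ‖f x‖) τ := by
  refine Integrable.of_bound
    (Real.continuous_cosh.comp_stronglyMeasurable hf.norm).aestronglyMeasurable (Real.cosh B)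
    (ae_of_all _ fun x => ?_)
  rw [Real.norm_eq_abs, abs_of_pos (Real.cosh_pos _), Real.cosh_le_cosh]
  exact abs_le_abs_of_nonneg (norm_nonneg _) (hB x)

variable [CompleteSpace E] {α : Type*} [MeasurableSpace α] (ν : Measure α) [IsProbabilityMeasure ν]

/-- Symmetrization: Jensen replaces the mean by an independent copy, exchangeability flips the sign
of the difference, and averaging both signs allows the parallelogram-type bound above. The `2 * B`
bounds the difference of the two copies. -/
theorem integral_cosh_norm_add_centered_le {Z : α → E} (hZ : StronglyMeasurable Z) {B : ℝ}
    (hB : ∀ x, ‖Z x‖ ≤ B) (s : E) :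
    ∫ x, Real.cosh ‖s + (Z x - ∫ y, Z y ∂ν)‖ ∂ν ≤ Real.cosh ‖s‖ * Real.cosh (2 * B) := by
  have hZi : Integrable Z ν := Integrable.of_bound hZ.aestronglyMeasurable B (ae_of_all _ hB)
  have hD : StronglyMeasurable (fun p : α × α => s + (Z p.1 - Z p.2)) :=
    stronglyMeasurable_const.add ((hZ.comp_measurable measurable_fst).sub
      (hZ.comp_measurable measurable_snd))
  have hDb : ∀ x y, ‖Z x - Z y‖ ≤ 2 * B := fun x y => by
    linarith [norm_sub_le (Z x) (Z y), hB x, hB y]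
  have hsDb : ∀ p : α × α, ‖s + (Z p.1 - Z p.2)‖ ≤ ‖s‖ + 2 * B := fun p =>
    (norm_add_le _ _).trans (by linarith [hDb p.1 p.2])
  have hI := integrable_cosh_norm_of_bound (ν.prod ν) hD hsDb
  have hD' : StronglyMeasurable (fun p : α × α => s - (Z p.1 - Z p.2)) :=
    stronglyMeasurable_const.sub ((hZ.comp_measurable measurable_fst).sub
      (hZ.comp_measurable measurable_snd))
  have hI' := integrable_cosh_norm_of_bound (ν.prod ν) hD' (B := ‖s‖ + 2 * B)
    (fun p => (norm_sub_le _ _).trans (by linarith [hDb p.1 p.2]))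
  have hmb : ‖∫ y, Z y ∂ν‖ ≤ B := by
    simpa using norm_integral_le_of_norm_le_const (ae_of_all ν hB)
  have step1 : ∀ x, Real.cosh ‖s + (Z x - ∫ y, Z y ∂ν)‖ ≤
      ∫ y, Real.cosh ‖s + (Z x - Z y)‖ ∂ν := by
    intro x
    have hfi : Integrable (fun y => s + (Z x - Z y)) ν :=
      (integrable_const s).add ((integrable_const (Z x)).sub hZi)
    have hgi : Integrable (fun y => Real.cosh ‖s + (Z x - Z y)‖) ν :=
      integrable_cosh_norm_of_bound ν
        (stronglyMeasurable_const.add (stronglyMeasurable_const.sub hZ))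
        (fun y => hsDb (x, y))
    have := convexOn_cosh_norm.map_integral_le (μ := ν) (f := fun y => s + (Z x - Z y))
      (Real.continuous_cosh.comp continuous_norm).continuousOn isClosed_univ
      (ae_of_all _ fun _ => mem_univ _) hfi hgi
    have he : ∫ y, s + (Z x - Z y) ∂ν = s + (Z x - ∫ y, Z y ∂ν) := by
      have h1 : Integrable (fun y => Z x - Z y) ν := (integrable_const (Z x)).sub hZi
      rw [integral_add (integrable_const s) h1, integral_sub (integrable_const (Z x)) hZi]
      simp
    rwa [he] at this
  have step2 : ∫ x, Real.cosh ‖s + (Z x - ∫ y, Z y ∂ν)‖ ∂ν ≤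
      ∫ p, Real.cosh ‖s + (Z p.1 - Z p.2)‖ ∂(ν.prod ν) := by
    rw [integral_prod _ hI]
    refine integral_mono ?_ hI.integral_prod_left step1
    refine integrable_cosh_norm_of_bound ν (B := ‖s‖ + 2 * B)
      (stronglyMeasurable_const.add (hZ.sub stronglyMeasurable_const)) fun x => ?_
    refine (norm_add_le _ _).trans ?_
    linarith [norm_sub_le (Z x) (∫ y, Z y ∂ν), hB x]
  have swap : ∫ p, Real.cosh ‖s + (Z p.1 - Z p.2)‖ ∂(ν.prod ν) =
      ∫ p, Real.cosh ‖s - (Z p.1 - Z p.2)‖ ∂(ν.prod ν) := by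
    rw [← integral_prod_swap]
    refine integral_congr_ae (ae_of_all _ fun p => ?_)
    simp only [Prod.fst_swap, Prod.snd_swap]
    congr 2
    abel
  have step3 : ∫ p, Real.cosh ‖s + (Z p.1 - Z p.2)‖ ∂(ν.prod ν) +
      ∫ p, Real.cosh ‖s - (Z p.1 - Z p.2)‖ ∂(ν.prod ν) ≤
      2 * (Real.cosh ‖s‖ * Real.cosh (2 * B)) := by
    rw [← integral_add hI hI']
    have : ∀ p : α × α, Real.cosh ‖s + (Z p.1 - Z p.2)‖ + Real.cosh ‖s - (Z p.1 - Z p.2)‖ ≤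
        2 * (Real.cosh ‖s‖ * Real.cosh (2 * B)) := by
      intro p
      refine (cosh_norm_add_add_cosh_norm_sub_le _ _).trans ?_
      have : Real.cosh ‖Z p.1 - Z p.2‖ ≤ Real.cosh (2 * B) := by
        rw [Real.cosh_le_cosh]
        exact abs_le_abs_of_nonneg (norm_nonneg _) (hDb _ _)
      have := Real.cosh_pos ‖s‖
      gcongr
    simpa using integral_mono (hI.add hI') (integrable_const _) this
  linarith

/-- The arbitrary shift `s` drives the induction: the first summand is absorbed into it, the
remaining ones are integrated out, and the one-variable bound finishes. -/
theorem integral_cosh_norm_add_sum_centered_le {Z : α → E} (hZ : StronglyMeasurable Z) {B : ℝ}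
    (hB : ∀ x, ‖Z x‖ ≤ B) (n : ℕ) (s : E) :
    ∫ x : Fin n → α, Real.cosh ‖s + ∑ a, (Z (x a) - ∫ y, Z y ∂ν)‖ ∂(Measure.pi fun _ => ν) ≤
      Real.cosh ‖s‖ * Real.cosh (2 * B) ^ n := by
  set m := ∫ y, Z y ∂ν with hm
  have hmb : ‖m‖ ≤ B := by
    simpa using norm_integral_le_of_norm_le_const (ae_of_all ν hB)
  have hsm : ∀ n : ℕ, StronglyMeasurable (fun x : Fin n → α => ∑ a, (Z (x a) - m)) := fun n =>
    Finset.stronglyMeasurable_fun_sum _ fun a _ =>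
      (hZ.comp_measurable (measurable_pi_apply a)).sub stronglyMeasurable_const
  have hsb : ∀ (n : ℕ) (x : Fin n → α), ‖∑ a, (Z (x a) - m)‖ ≤ n * (2 * B) := by
    intro n x
    refine (norm_sum_le _ _).trans ?_
    have : ∀ a ∈ (Finset.univ : Finset (Fin n)), ‖Z (x a) - m‖ ≤ 2 * B := fun a _ => by
      linarith [norm_sub_le (Z (x a)) m, hB (x a)]
    simpa using Finset.sum_le_sum this
  induction n generalizing s with
  | zero => simp
  | succ n ih =>
    have hmp := measurePreserving_piFinSuccAbove (fun _ : Fin (n + 1) => ν) 0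
    have hrw : ∫ x : Fin (n + 1) → α, Real.cosh ‖s + ∑ a, (Z (x a) - m)‖
          ∂(Measure.pi fun _ => ν) =
        ∫ p : α × (Fin n → α), Real.cosh ‖(s + (Z p.1 - m)) + ∑ a, (Z (p.2 a) - m)‖
          ∂(ν.prod (Measure.pi fun _ => ν)) := by
      rw [← hmp.integral_comp (MeasurableEquiv.measurableEmbedding _)]
      refine integral_congr_ae (ae_of_all _ fun x => ?_)
      simp only [Fin.sum_univ_succ, MeasurableEquiv.piFinSuccAbove_apply, add_assoc]
      rfl
    have hI : Integrable (fun p : α × (Fin n → α) =>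
        Real.cosh ‖(s + (Z p.1 - m)) + ∑ a, (Z (p.2 a) - m)‖)
        (ν.prod (Measure.pi fun _ => ν)) := by
      refine integrable_cosh_norm_of_bound _ (B := ‖s‖ + 2 * B + n * (2 * B)) ?_ fun p => ?_
      · exact (stronglyMeasurable_const.add
          ((hZ.comp_measurable measurable_fst).sub stronglyMeasurable_const)).add
          ((hsm n).comp_measurable measurable_snd)
      · have h1 := norm_add_le (s + (Z p.1 - m)) (∑ a, (Z (p.2 a) - m))
        have h2 := norm_add_le s (Z p.1 - m)
        have h3 := norm_sub_le (Z p.1) m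
        linarith [hsb n p.2, hB p.1]
    rw [hrw, integral_prod _ hI]
    calc _ ≤ ∫ x, Real.cosh ‖s + (Z x - m)‖ * Real.cosh (2 * B) ^ n ∂ν := by
          refine integral_mono hI.integral_prod_left ?_ fun x => ih (s + (Z x - m))
          refine Integrable.mul_const ?_ _
          refine integrable_cosh_norm_of_bound ν (B := ‖s‖ + 2 * B)
            (stronglyMeasurable_const.add (hZ.sub stronglyMeasurable_const)) fun x => ?_
          have h2 := norm_add_le s (Z x - m)
          have h3 := norm_sub_le (Z x) m
          linarith [hB x]
      _ = (∫ x, Real.cosh ‖s + (Z x - m)‖ ∂ν) * Real.cosh (2 * B) ^ n := integral_mul_const _ _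
      _ ≤ (Real.cosh ‖s‖ * Real.cosh (2 * B)) * Real.cosh (2 * B) ^ n := by
          exact mul_le_mul_of_nonneg_right (integral_cosh_norm_add_centered_le ν hZ hB s)
            (pow_nonneg (Real.cosh_pos _).le _)
      _ = _ := by ring

/-- Hoeffding's inequality for bounded independent variables in a Hilbert space. -/
theorem measureReal_norm_sum_centered_ge_le {Z : α → E} (hZ : StronglyMeasurable Z) {B : ℝ}
    (hB : ∀ x, ‖Z x‖ ≤ B) (hB0 : 0 < B) (n : ℕ) {r : ℝ} (hr : 0 < r) :
    (Measure.pi fun _ : Fin n => ν).real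
        {x | n * r ≤ ‖∑ a, (Z (x a) - ∫ y, Z y ∂ν)‖} ≤
      2 * Real.exp (-(n * r ^ 2 / (8 * B ^ 2))) := by
  -- Minimizer of the Chernoff exponent `2 n t² B² - t n r`.
  set t : ℝ := r / (4 * B ^ 2) with ht
  have ht0 : 0 < t := by positivity
  have hint : ∫ y, t • Z y ∂ν = t • ∫ y, Z y ∂ν := integral_smul _ _
  have hb : ∀ x, ‖t • Z x‖ ≤ t * B := fun x => by
    rw [norm_smul, Real.norm_eq_abs, abs_of_pos ht0]
    exact mul_le_mul_of_nonneg_left (hB x) ht0.le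
  have hmain : ∫ x : Fin n → α, Real.cosh ‖(0 : E) + ∑ a, (t • Z (x a) - ∫ y, t • Z y ∂ν)‖
      ∂(Measure.pi fun _ => ν) ≤ Real.cosh ‖(0 : E)‖ * Real.cosh (2 * (t * B)) ^ n :=
    integral_cosh_norm_add_sum_centered_le ν (hZ.const_smul t) hb n 0
  have hconv : ∀ x : Fin n → α, ‖(0 : E) + ∑ a, (t • Z (x a) - ∫ y, t • Z y ∂ν)‖ =
      t * ‖∑ a, (Z (x a) - ∫ y, Z y ∂ν)‖ := by
    intro x
    rw [hint, zero_add]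
    simp_rw [← smul_sub]
    rw [← Finset.smul_sum, norm_smul, Real.norm_eq_abs, abs_of_pos ht0]
  simp_rw [hconv, norm_zero, Real.cosh_zero, one_mul] at hmain
  set W : (Fin n → α) → ℝ := fun x => ‖∑ a, (Z (x a) - ∫ y, Z y ∂ν)‖ with hW
  have hWm : StronglyMeasurable fun x : Fin n → α => t • ∑ a, (Z (x a) - ∫ y, Z y ∂ν) :=
    (Finset.stronglyMeasurable_fun_sum _ fun a _ =>
      (hZ.comp_measurable (measurable_pi_apply a)).sub stronglyMeasurable_const).const_smul t
  have hWn : ∀ x, ‖t • ∑ a, (Z (x a) - ∫ y, Z y ∂ν)‖ = t * W x := fun x => by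
    rw [norm_smul, Real.norm_eq_abs, abs_of_pos ht0]
  have hWb : ∀ x, W x ≤ n * (2 * B) := by
    intro x
    refine (norm_sum_le _ _).trans ?_
    have hmb : ‖∫ y, Z y ∂ν‖ ≤ B := by
      simpa using norm_integral_le_of_norm_le_const (ae_of_all ν hB)
    have : ∀ a ∈ (Finset.univ : Finset (Fin n)), ‖Z (x a) - ∫ y, Z y ∂ν‖ ≤ 2 * B := fun a _ => by
      linarith [norm_sub_le (Z (x a)) (∫ y, Z y ∂ν), hB (x a)]
    simpa using Finset.sum_le_sum this
  have hI : Integrable (fun x => Real.cosh (t * W x)) (Measure.pi fun _ : Fin n => ν) := by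
    have := integrable_cosh_norm_of_bound (Measure.pi fun _ : Fin n => ν) hWm
      (B := t * (n * (2 * B)))
      (fun x => by rw [hWn]; exact mul_le_mul_of_nonneg_left (hWb x) ht0.le)
    simpa only [hWn] using this
  have hmk := mul_meas_ge_le_integral_of_nonneg
    (ae_of_all _ fun x => (Real.cosh_pos (t * W x)).le) hI (Real.cosh (t * (n * r)))
  have hsub : {x : Fin n → α | n * r ≤ W x} ⊆
      {x | Real.cosh (t * (n * r)) ≤ Real.cosh (t * W x)} := by
    intro x hx
    rw [mem_ofPred_eq, Real.cosh_le_cosh]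
    exact abs_le_abs_of_nonneg (by positivity) (mul_le_mul_of_nonneg_left hx ht0.le)
  have h1 := measureReal_mono (μ := Measure.pi fun _ : Fin n => ν) hsub
  have hcosh : Real.cosh (2 * (t * B)) ^ n ≤ Real.exp (n * r ^ 2 / (8 * B ^ 2)) := by
    calc _ ≤ Real.exp ((2 * (t * B)) ^ 2 / 2) ^ n := by
          exact pow_le_pow_left₀ (Real.cosh_pos _).le (Real.cosh_le_exp_half_sq _) n
      _ = _ := by
          rw [← Real.exp_nat_mul, ht]
          congr 1
          field_simp
          ring
  have hexp : Real.exp (t * (n * r)) ≤ 2 * Real.cosh (t * (n * r)) := by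
    rw [Real.cosh_eq]
    linarith [Real.exp_pos (-(t * (n * r)))]
  have hsplit : t * (n * r) = n * r ^ 2 / (8 * B ^ 2) + n * r ^ 2 / (8 * B ^ 2) := by
    rw [ht]; field_simp; ring
  rw [hsplit, Real.exp_add, ← hsplit] at hexp
  have he := Real.exp_pos (n * r ^ 2 / (8 * B ^ 2))
  rw [Real.exp_neg, ← div_eq_mul_inv, le_div_iff₀ he]
  set p := (Measure.pi fun _ : Fin n => ν).real {x | n * r ≤ W x}
  have hp : 0 ≤ p := measureReal_nonneg
  have hc := Real.cosh_pos (t * (n * r))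
  have h2 : Real.cosh (t * (n * r)) * p ≤ Real.exp (n * r ^ 2 / (8 * B ^ 2)) :=
    ((mul_le_mul_of_nonneg_left h1 hc.le).trans hmk).trans (hmain.trans hcosh)
  have h3 := mul_le_mul_of_nonneg_right hexp hp
  refine le_of_mul_le_mul_right ?_ he
  nlinarith

end Hilbert

/-! ### Difference quotients and higher derivatives on the unit interval -/

theorem fwdDiff_iter_eq_sum_real {F : Type*} [AddCommGroup F] [Module ℝ F] (h : ℝ) (k : ℕ)
    (f : ℝ → F) (a : ℝ) :
    (fwdDiff h)^[k] f a =
      ∑ i ∈ Finset.range (k + 1), ((-1 : ℝ) ^ (k - i) * (k.choose i : ℝ)) • f (a + i * h) := by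
  rw [fwdDiff_iter_eq_sum_shift]
  refine Finset.sum_congr rfl fun i _ => ?_
  rw [nsmul_eq_mul, ← Int.cast_smul_eq_zsmul ℝ]
  push_cast
  rfl

theorem hasDerivWithinAt_shift_sub {f f' : ℝ → ℝ} {a b h : ℝ} (hh : 0 < h)
    (hf : ∀ x ∈ Icc a b, HasDerivWithinAt f (f' x) (Icc a b) x) :
    ∀ x ∈ Icc a (b - h), HasDerivWithinAt (fun x => f (x + h) - f x) (f' (x + h) - f' x)
      (Icc a (b - h)) x := by
  intro x hx
  have h1 : MapsTo (fun x => x + h) (Icc a (b - h)) (Icc a b) := fun y hy =>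
    ⟨by linarith [hy.1], by linarith [hy.2]⟩
  have h2 : Icc a (b - h) ⊆ Icc a b := Icc_subset_Icc_right (by linarith)
  have h3 := (hf (x + h) (h1 hx)).scomp x ((hasDerivWithinAt_id x _).add_const h) h1
  have h4 : HasDerivWithinAt (fun x => f (x + h)) (f' (x + h)) (Icc a (b - h)) x := by
    simpa [Function.comp_def] using h3
  exact h4.sub ((hf x (h2 hx)).mono h2)

/-- Mean value theorem of order `k`: the induction hypothesis is applied to the chain of first
differences on an interval shortened by `h`, and the classical theorem then handles the remaining
difference of `F k`. -/
theorem exists_fwdDiff_iter_eq {k : ℕ} {F : ℕ → ℝ → ℝ} {a b h : ℝ} (hh : 0 < h)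
    (hab : a + k * h ≤ b)
    (hF : ∀ i < k, ∀ x ∈ Icc a b, HasDerivWithinAt (F i) (F (i + 1) x) (Icc a b) x) :
    ∃ ξ ∈ Icc a (a + k * h), (fwdDiff h)^[k] (F 0) a = h ^ k * F k ξ := by
  induction k generalizing F b with
  | zero => exact ⟨a, by simp, by simp⟩
  | succ k ih =>
    push_cast at hab
    obtain ⟨ξ, hξ, he⟩ := ih (F := fun i x => F i (x + h) - F i x) (b := b - h) (by linarith)
      (fun i hi => hasDerivWithinAt_shift_sub hh (hF i (by omega)))
    have hsub : Icc ξ (ξ + h) ⊆ Icc a b := Icc_subset_Icc hξ.1 (by linarith [hξ.2])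
    obtain ⟨c, hc, hce⟩ := exists_hasDerivAt_eq_slope (F k) (F (k + 1))
      (show ξ < ξ + h by linarith)
      (fun x hx => ((hF k (by omega) x (hsub hx)).continuousWithinAt).mono hsub)
      (fun x hx => (hF k (by omega) x (hsub (Ioo_subset_Icc_self hx))).hasDerivAt
        (mem_of_superset (Icc_mem_nhds hx.1 hx.2) hsub))
    refine ⟨c, ⟨by linarith [hξ.1, hc.1], ?_⟩, ?_⟩
    · push_cast
      linarith [hξ.2, hc.2]
    · rw [Function.iterate_succ_apply]
      refine he.trans ?_
      rw [hce]
      simp only [add_sub_cancel_left]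
      field_simp
      ring

/-- Leaves the last difference unevaluated, so that the top derivative is needed only at the limit
point and not its continuity. -/
theorem exists_fwdDiff_iter_succ_eq {k : ℕ} {F : ℕ → ℝ → ℝ} {a b h : ℝ} (hh : 0 < h)
    (hab : a + (k + 1) * h ≤ b)
    (hF : ∀ i < k, ∀ x ∈ Icc a b, HasDerivWithinAt (F i) (F (i + 1) x) (Icc a b) x) :
    ∃ ξ ∈ Icc a (a + k * h), (fwdDiff h)^[k + 1] (F 0) a = h ^ k * (F k (ξ + h) - F k ξ) :=
  exists_fwdDiff_iter_eq (F := fun i x => F i (x + h) - F i x) (b := b - h) hh (by linarith)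
    (fun i hi => hasDerivWithinAt_shift_sub hh (hF i hi))

theorem tendsto_straddled_slope {f : ℝ → ℝ} {f' x : ℝ} {s : Set ℝ} (hf : HasDerivWithinAt f f' s x)
    {ξ h : ℕ → ℝ} {C : ℝ} (hpos : ∀ n, 0 < h n) (hlim : Tendsto h atTop (𝓝 0))
    (h1 : ∀ n, ξ n ∈ s) (h2 : ∀ n, ξ n + h n ∈ s) (h3 : ∀ n, |ξ n - x| ≤ C * h n)
    (h4 : ∀ n, |ξ n + h n - x| ≤ C * h n) :
    Tendsto (fun n => (f (ξ n + h n) - f (ξ n)) / h n) atTop (𝓝 f') := by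
  have hC : 0 ≤ C := by
    by_contra hc
    have := (abs_nonneg _).trans (h3 0)
    nlinarith [hpos 0]
  have hCh : Tendsto (fun n => C * h n) atTop (𝓝 0) := by simpa using hlim.const_mul C
  have key : ∀ u : ℕ → ℝ, (∀ n, u n ∈ s) → (∀ n, |u n - x| ≤ C * h n) →
      ∀ c : ℝ, 0 < c → ∀ᶠ n in atTop, |f (u n) - f x - (u n - x) * f'| ≤ c * (C * h n) := by
    intro u hu hub c hc
    have hu0 : Tendsto u atTop (𝓝[s] x) := by
      refine tendsto_nhdsWithin_iff.2 ⟨?_, Eventually.of_forall hu⟩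
      rw [tendsto_iff_dist_tendsto_zero]
      exact squeeze_zero (fun _ => dist_nonneg) hub hCh
    have := (hasDerivWithinAt_iff_isLittleO.1 hf).def hc
    filter_upwards [hu0.eventually this] with n hn
    simp only [Real.norm_eq_abs, smul_eq_mul] at hn
    exact hn.trans (mul_le_mul_of_nonneg_left (hub n) hc.le)
  rw [Metric.tendsto_atTop']
  intro ε hε
  have hc : 0 < ε / (2 * C + 1) := by positivity
  obtain ⟨N, hN⟩ := eventually_atTop.1 ((key ξ h1 h3 _ hc).and (key (fun n => ξ n + h n) h2 h4 _ hc))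
  refine ⟨N, fun n hn => ?_⟩
  obtain ⟨e1, e2⟩ := hN n hn.le
  have hp := hpos n
  rw [Real.dist_eq]
  have : (f (ξ n + h n) - f (ξ n)) / h n - f' =
      ((f (ξ n + h n) - f x - (ξ n + h n - x) * f') - (f (ξ n) - f x - (ξ n - x) * f')) / h n := by
    field_simp
    ring
  rw [this, abs_div, abs_of_pos hp, div_lt_iff₀ hp]
  refine (abs_sub _ _).trans_lt ?_
  have h5 : ε / (2 * C + 1) * (2 * C) < ε := by
    rw [div_mul_eq_mul_div, div_lt_iff₀ (by positivity)]
    nlinarith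
  nlinarith

/-- The step of the `N`-th difference quotient of order `j` on `[0,1]`. -/
noncomputable def diffStep (j N : ℕ) : ℝ := 1 / ((N : ℝ) + j + 1)

theorem diffStep_pos (j N : ℕ) : 0 < diffStep j N := by unfold diffStep; positivity

theorem mul_diffStep_le_one (j N : ℕ) : j * diffStep j N ≤ 1 := by
  unfold diffStep
  rw [mul_one_div, div_le_one (by positivity)]
  linarith [(Nat.cast_nonneg N : (0 : ℝ) ≤ N)]

theorem tendsto_diffStep (j : ℕ) : Tendsto (diffStep j) atTop (𝓝 0) := by
  unfold diffStep
  simp_rw [one_div]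
  refine Tendsto.inv_tendsto_atTop ?_
  exact tendsto_atTop_add_const_right _ _
    (tendsto_atTop_add_const_right _ _ tendsto_natCast_atTop_atTop)

/-- The base point of the `N`-th difference quotient of order `j` at `x`: all its nodes lie in
`[0,1]` as soon as `x` does. -/
noncomputable def diffBase (j N : ℕ) (x : ℝ) : ℝ := x * (1 - j * diffStep j N)

theorem diffBase_nonneg {j N : ℕ} {x : ℝ} (hx : x ∈ I01) : 0 ≤ diffBase j N x :=
  mul_nonneg hx.1 (by linarith [mul_diffStep_le_one j N])

theorem diffBase_add_le_one {j N : ℕ} {x : ℝ} (hx : x ∈ I01) :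
    diffBase j N x + j * diffStep j N ≤ 1 := by
  unfold diffBase
  nlinarith [mul_diffStep_le_one j N, hx.2]

theorem mem_I01_of_mem_Icc_diffBase {j N : ℕ} {x ξ : ℝ} (hx : x ∈ I01)
    (hξ : ξ ∈ Icc (diffBase j N x) (diffBase j N x + j * diffStep j N)) :
    ξ ∈ I01 ∧ |ξ - x| ≤ j * diffStep j N := by
  have h0 := diffBase_nonneg (j := j) (N := N) hx
  have h1 := diffBase_add_le_one (j := j) (N := N) hx
  have hs : 0 ≤ j * diffStep j N := mul_nonneg (Nat.cast_nonneg _) (diffStep_pos _ _).le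
  refine ⟨⟨h0.trans hξ.1, hξ.2.trans h1⟩, ?_⟩
  -- The interval of nodes contains `x`, dividing it in the ratio `x : 1 - x`.
  have e : diffBase j N x = x - x * (j * diffStep j N) := by unfold diffBase; ring
  rw [e] at hξ
  rw [abs_le]
  constructor
  · nlinarith [hξ.1, hx.2]
  · nlinarith [hξ.2, hx.1]

theorem diffNode_mem {j N i : ℕ} {x : ℝ} (hx : x ∈ I01) (hi : i ∈ Finset.range (j + 1)) :
    diffBase j N x + i * diffStep j N ∈ I01 := by
  refine (mem_I01_of_mem_Icc_diffBase (j := j) (N := N) hx ⟨?_, ?_⟩).1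
  · linarith [mul_nonneg (Nat.cast_nonneg i : (0 : ℝ) ≤ i) (diffStep_pos j N).le]
  · have : (i : ℝ) ≤ j := by exact_mod_cast Nat.lt_succ_iff.1 (Finset.mem_range.1 hi)
    linarith [mul_le_mul_of_nonneg_right this (diffStep_pos j N).le]

/-- The `N`-th difference quotient of order `j` of `f` at `x`. -/
noncomputable def diffQuot {F : Type*} [AddCommGroup F] [Module ℝ F] (j N : ℕ) (f : ℝ → F) (x : ℝ) :
    F :=
  (diffStep j N ^ j)⁻¹ • (fwdDiff (diffStep j N))^[j] f (diffBase j N x)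

theorem diffQuot_eq_sum {F : Type*} [AddCommGroup F] [Module ℝ F] (j N : ℕ) (f : ℝ → F) (x : ℝ) :
    diffQuot j N f x = ∑ i ∈ Finset.range (j + 1),
      ((diffStep j N ^ j)⁻¹ * ((-1 : ℝ) ^ (j - i) * (j.choose i : ℝ))) •
        f (diffBase j N x + i * diffStep j N) := by
  rw [diffQuot, fwdDiff_iter_eq_sum_real, Finset.smul_sum]
  simp_rw [smul_smul]

theorem diffQuot_congr {F : Type*} [AddCommGroup F] [Module ℝ F] {j N : ℕ} {f g : ℝ → F} {x : ℝ}
    (hx : x ∈ I01) (h : EqOn f g I01) : diffQuot j N f x = diffQuot j N g x := by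
  simp_rw [diffQuot_eq_sum]
  refine Finset.sum_congr rfl fun i hi => ?_
  rw [h (diffNode_mem hx hi)]

theorem TimesDiff.hasDerivWithinAt {j : ℕ} {f : ℝ → ℝ} (hf : TimesDiff j f) {i : ℕ} (hi : i < j)
    {x : ℝ} (hx : x ∈ I01) :
    HasDerivWithinAt (iteratedDerivWithin i f I01) (iteratedDerivWithin (i + 1) f I01 x) I01 x := by
  rw [iteratedDerivWithin_succ]
  exact (hf i hi x hx).hasDerivWithinAt

theorem exists_diffQuot_eq_of_chain {j : ℕ} (N : ℕ) {F : ℕ → ℝ → ℝ}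
    (hF : ∀ i < j, ∀ x ∈ I01, HasDerivWithinAt (F i) (F (i + 1) x) I01 x) {x : ℝ} (hx : x ∈ I01) :
    ∃ ξ ∈ I01, |ξ - x| ≤ j * diffStep j N ∧ diffQuot j N (F 0) x = F j ξ := by
  have hsub : Icc (diffBase j N x) 1 ⊆ I01 := Icc_subset_Icc_left (diffBase_nonneg hx)
  obtain ⟨ξ, hξ, he⟩ := exists_fwdDiff_iter_eq (diffStep_pos j N) (diffBase_add_le_one hx)
    (fun i hi x hx => (hF i hi x (hsub hx)).mono hsub)
  obtain ⟨h1, h2⟩ := mem_I01_of_mem_Icc_diffBase hx hξ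
  refine ⟨ξ, h1, h2, ?_⟩
  rw [diffQuot, he, smul_eq_mul, inv_mul_cancel_left₀ (pow_ne_zero _ (diffStep_pos j N).ne')]

theorem tendsto_diffQuot {j : ℕ} {f : ℝ → ℝ} (hf : TimesDiff j f) {x : ℝ} (hx : x ∈ I01) :
    Tendsto (fun N => diffQuot j N f x) atTop (𝓝 (iteratedDerivWithin j f I01 x)) := by
  cases j with
  | zero => simp [diffQuot, diffBase]
  | succ j =>
    have H : ∀ N, ∃ ξ, ξ ∈ Icc (diffBase (j + 1) N x) (diffBase (j + 1) N x + j * diffStep (j + 1) N) ∧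
        diffQuot (j + 1) N f x = (iteratedDerivWithin j f I01 (ξ + diffStep (j + 1) N) -
          iteratedDerivWithin j f I01 ξ) / diffStep (j + 1) N := by
      intro N
      have hsub : Icc (diffBase (j + 1) N x) 1 ⊆ I01 := Icc_subset_Icc_left (diffBase_nonneg hx)
      have hb := diffBase_add_le_one (j := j + 1) (N := N) hx
      push_cast at hb
      have hp := diffStep_pos (j + 1) N
      obtain ⟨ξ, hξ, he⟩ := exists_fwdDiff_iter_succ_eq (k := j)
        (F := fun i => iteratedDerivWithin i f I01) hp hb
        (fun i hi x hx => (hf.hasDerivWithinAt (by omega : i < j + 1) (hsub hx)).mono hsub)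
      refine ⟨ξ, hξ, ?_⟩
      rw [iteratedDerivWithin_zero] at he
      rw [diffQuot, he, smul_eq_mul]
      field_simp
      ring
    choose ξ hξ he using H
    simp_rw [he]
    have hp := diffStep_pos (j + 1)
    have m1 : ∀ N, ξ N ∈ Icc (diffBase (j + 1) N x)
        (diffBase (j + 1) N x + (j + 1 : ℕ) * diffStep (j + 1) N) := fun N =>
      ⟨(hξ N).1, by push_cast; linarith [(hξ N).2, hp N]⟩
    have m2 : ∀ N, ξ N + diffStep (j + 1) N ∈ Icc (diffBase (j + 1) N x)
        (diffBase (j + 1) N x + (j + 1 : ℕ) * diffStep (j + 1) N) := fun N =>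
      ⟨by linarith [(hξ N).1, hp N], by push_cast; linarith [(hξ N).2, hp N]⟩
    exact tendsto_straddled_slope (hf.hasDerivWithinAt (Nat.lt_succ_self j) hx) hp
      (tendsto_diffStep _) (fun N => (mem_I01_of_mem_Icc_diffBase hx (m1 N)).1)
      (fun N => (mem_I01_of_mem_Icc_diffBase hx (m2 N)).1)
      (fun N => (mem_I01_of_mem_Icc_diffBase hx (m1 N)).2)
      (fun N => (mem_I01_of_mem_Icc_diffBase hx (m2 N)).2)

/-! ### Differentiability of the feature map -/

section FeatureMap

variable {H : Type*} [NormedAddCommGroup H] [InnerProductSpace ℝ H]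

theorem inner_diffQuot (j N : ℕ) (ψ : ℝ → H) (v : H) (x : ℝ) :
    inner ℝ v (diffQuot j N ψ x) = diffQuot j N (fun t => inner ℝ v (ψ t)) x := by
  simp_rw [diffQuot_eq_sum, inner_sum, real_inner_smul_right, smul_eq_mul]

/-- Two successive mean value theorems. The second variable goes first, since differentiability in
the first one is assumed only for the `j`-th derivative in the second. -/
theorem exists_inner_diffQuot_eq_mixedDeriv {K : ℝ → ℝ → ℝ} {ψ : ℝ → H} {j : ℕ}
    (hψ : ∀ x ∈ I01, ∀ y ∈ I01, inner ℝ (ψ x) (ψ y) = K x y)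
    (h1 : ∀ x ∈ I01, TimesDiff j (fun x' => K x x'))
    (h2 : ∀ x' ∈ I01, TimesDiff j (fun x => iteratedDerivWithin j (fun t => K x t) I01 x'))
    (N N' : ℕ) {x x' : ℝ} (hx : x ∈ I01) (hx' : x' ∈ I01) :
    ∃ ξ ∈ I01, ∃ ξ' ∈ I01, |ξ - x| ≤ j * diffStep j N ∧ |ξ' - x'| ≤ j * diffStep j N' ∧
      inner ℝ (diffQuot j N ψ x) (diffQuot j N' ψ x') = mixedDeriv j j K ξ ξ' := by
  set c : ℕ → ℝ := fun i => (diffStep j N ^ j)⁻¹ * ((-1 : ℝ) ^ (j - i) * (j.choose i : ℝ)) with hc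
  set p : ℕ → ℝ := fun i => diffBase j N x + i * diffStep j N with hp
  have hq : ∀ f : ℝ → ℝ, diffQuot j N f x = ∑ i ∈ Finset.range (j + 1), c i * f (p i) := fun f => by
    simp only [diffQuot_eq_sum, smul_eq_mul, hc, hp]
  let F : ℕ → ℝ → ℝ := fun m t =>
    ∑ i ∈ Finset.range (j + 1), c i * iteratedDerivWithin m (fun t => K (p i) t) I01 t
  have hF : ∀ m < j, ∀ t ∈ I01, HasDerivWithinAt (F m) (F (m + 1) t) I01 t := by
    intro m hm t ht
    refine HasDerivWithinAt.fun_sum fun i hi => ?_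
    exact ((h1 (p i) (diffNode_mem hx hi)).hasDerivWithinAt hm ht).const_mul (c i)
  obtain ⟨ξ', hξ', hd', he'⟩ := exists_diffQuot_eq_of_chain N' hF hx'
  have hG : ∀ m < j, ∀ t ∈ I01, HasDerivWithinAt
      (iteratedDerivWithin m (fun s => iteratedDerivWithin j (fun t => K s t) I01 ξ') I01)
      (iteratedDerivWithin (m + 1) (fun s => iteratedDerivWithin j (fun t => K s t) I01 ξ') I01 t)
      I01 t := fun m hm t ht => (h2 ξ' hξ').hasDerivWithinAt hm ht
  obtain ⟨ξ, hξ, hd, he⟩ := exists_diffQuot_eq_of_chain N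
    (F := fun m => iteratedDerivWithin m (fun s => iteratedDerivWithin j (fun t => K s t) I01 ξ') I01)
    hG hx
  refine ⟨ξ, hξ, ξ', hξ', hd, hd', ?_⟩
  rw [inner_diffQuot]
  have e1 : EqOn (fun t => inner ℝ (diffQuot j N ψ x) (ψ t)) (F 0) I01 := by
    intro t ht
    simp only [diffQuot_eq_sum, sum_inner, real_inner_smul_left, F, iteratedDerivWithin_zero]
    refine Finset.sum_congr rfl fun i hi => ?_
    rw [hψ _ (diffNode_mem hx hi) t ht]
  rw [diffQuot_congr hx' e1, he', mixedDeriv, ← he, hq]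
  simp only [iteratedDerivWithin_zero, F]

end FeatureMap

section FeatureMap

variable {H : Type*} [NormedAddCommGroup H] [InnerProductSpace ℝ H]

theorem tendsto_inner_diffQuot {K : ℝ → ℝ → ℝ} {ψ : ℝ → H} {j k : ℕ} (hK : IsC2k k K) (hj : j ≤ k)
    (hψ : ∀ x ∈ I01, ∀ y ∈ I01, inner ℝ (ψ x) (ψ y) = K x y) {x y : ℝ} (hx : x ∈ I01)
    (hy : y ∈ I01) :
    Tendsto (fun p : ℕ × ℕ => inner ℝ (diffQuot j p.1 ψ x) (diffQuot j p.2 ψ y)) atTop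
      (𝓝 (mixedDeriv j j K x y)) := by
  obtain ⟨h1, h2, h3⟩ := hK j hj
  have hex := fun p : ℕ × ℕ => exists_inner_diffQuot_eq_mixedDeriv hψ h1 h2 p.1 p.2 hx hy
  choose ξ hξ ξ' hξ' hd hd' he using hex
  rw [tendsto_congr he]
  have hs : Tendsto (fun N => (j : ℝ) * diffStep j N) atTop (𝓝 0) := by
    simpa using (tendsto_diffStep j).const_mul (j : ℝ)
  have t1 : Tendsto ξ atTop (𝓝 x) := by
    rw [tendsto_iff_dist_tendsto_zero]
    refine squeeze_zero (fun _ => dist_nonneg) hd ?_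
    rw [← prod_atTop_atTop_eq]
    exact hs.comp tendsto_fst
  have t2 : Tendsto ξ' atTop (𝓝 y) := by
    rw [tendsto_iff_dist_tendsto_zero]
    refine squeeze_zero (fun _ => dist_nonneg) hd' ?_
    rw [← prod_atTop_atTop_eq]
    exact hs.comp tendsto_snd
  have t3 : Tendsto (fun p => (ξ p, ξ' p)) atTop (𝓝[I01 ×ˢ I01] (x, y)) :=
    tendsto_nhdsWithin_iff.2 ⟨t1.prodMk_nhds t2, Eventually.of_forall fun p => ⟨hξ p, hξ' p⟩⟩
  have hc : Tendsto (fun p : ℝ × ℝ => mixedDeriv j j K p.1 p.2) (𝓝[I01 ×ˢ I01] (x, y))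
      (𝓝 (mixedDeriv j j K x y)) := h3 (x, y) ⟨hx, hy⟩
  have hfin := hc.comp t3
  simp only [Function.comp_def] at hfin
  exact hfin

theorem dist_sq_eq_inner (a b : H) :
    dist a b ^ 2 = inner ℝ a a - 2 * inner ℝ a b + inner ℝ b b := by
  rw [dist_eq_norm, norm_sub_sq_real, real_inner_self_eq_norm_sq, real_inner_self_eq_norm_sq]

theorem tendsto_zero_of_sq {ι : Type*} {l : Filter ι} {u : ι → ℝ} (h0 : ∀ i, 0 ≤ u i)
    (h : Tendsto (fun i => u i ^ 2) l (𝓝 0)) : Tendsto u l (𝓝 0) := by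
  have := h.sqrt
  simpa [Real.sqrt_sq (h0 _)] using this

theorem continuousOn_of_inner {g : ℝ → H} {L : ℝ → ℝ → ℝ} {s : Set ℝ}
    (hL : ContinuousOn (fun p : ℝ × ℝ => L p.1 p.2) (s ×ˢ s))
    (hg : ∀ x ∈ s, ∀ y ∈ s, inner ℝ (g x) (g y) = L x y) : ContinuousOn g s := by
  intro x hx
  rw [ContinuousWithinAt, tendsto_iff_dist_tendsto_zero]
  refine tendsto_zero_of_sq (fun _ => dist_nonneg) ?_
  have hid : Tendsto (fun y : ℝ => y) (𝓝[s] x) (𝓝 x) := tendsto_nhdsWithin_of_tendsto_nhds tendsto_id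
  have hm : ∀ᶠ y in 𝓝[s] x, y ∈ s := eventually_mem_nhdsWithin
  have t1 : Tendsto (fun y => L y y) (𝓝[s] x) (𝓝 (L x x)) :=
    Tendsto.comp (hL (x, x) ⟨hx, hx⟩) (tendsto_nhdsWithin_iff.2
      ⟨hid.prodMk_nhds hid, hm.mono fun y hy => ⟨hy, hy⟩⟩)
  have t2 : Tendsto (fun y => L y x) (𝓝[s] x) (𝓝 (L x x)) :=
    Tendsto.comp (hL (x, x) ⟨hx, hx⟩) (tendsto_nhdsWithin_iff.2
      ⟨hid.prodMk_nhds tendsto_const_nhds, hm.mono fun y hy => ⟨hy, hx⟩⟩)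
  have t3 : Tendsto (fun y => L y y - 2 * L y x + L x x) (𝓝[s] x) (𝓝 0) := by
    have := (t1.sub (t2.const_mul 2)).add_const (L x x)
    convert this using 2
    ring
  refine t3.congr' (hm.mono fun y hy => ?_)
  simp only [dist_sq_eq_inner]
  rw [hg y hy y hy, hg y hy x hx, hg x hx x hx]

/-- A weak derivative tested on a dense subspace is a strong one if it is norm continuous: the mean
value inequality bounds `⟨u, R⟩` for the Taylor remainder `R` by `ε |y - x| ‖u‖`, uniformly in `u`.
This closed condition extends to `u = R`. -/
theorem hasDerivWithinAt_of_inner_dense {g g' : ℝ → H} {V : Submodule ℝ H}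
    (hV : V.topologicalClosure = ⊤) (hg' : ContinuousOn g' I01)
    (h : ∀ u ∈ V, ∀ x ∈ I01, HasDerivWithinAt (fun s => inner ℝ u (g s)) (inner ℝ u (g' x)) I01 x)
    {x : ℝ} (hx : x ∈ I01) : HasDerivWithinAt g (g' x) I01 x := by
  rw [hasDerivWithinAt_iff_isLittleO, Asymptotics.isLittleO_iff]
  intro ε hε
  have hc := Metric.continuousWithinAt_iff.1 (hg' x hx) ε hε
  obtain ⟨δ, hδ, hδ'⟩ := hc
  have hball : ∀ᶠ y in 𝓝[I01] x, y ∈ I01 ∩ Metric.ball x δ :=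
    inter_mem eventually_mem_nhdsWithin (mem_nhdsWithin_of_mem_nhds (Metric.ball_mem_nhds x hδ))
  filter_upwards [hball] with y hy
  set R := g y - g x - (y - x) • g' x with hR
  have key : ∀ u ∈ V, ‖inner ℝ u R‖ ≤ ε * ‖y - x‖ * ‖u‖ := by
    intro u hu
    have hd : ∀ s ∈ I01 ∩ Metric.ball x δ,
        HasDerivWithinAt (fun s => inner ℝ u (g s) - s * inner ℝ u (g' x))
          (inner ℝ u (g' s) - 1 * inner ℝ u (g' x)) (I01 ∩ Metric.ball x δ) s := fun s hs =>
      ((h u hu s hs.1).mono inter_subset_left).sub ((hasDerivWithinAt_id s _).mul_const _)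
    have hb : ∀ s ∈ I01 ∩ Metric.ball x δ,
        ‖inner ℝ u (g' s) - 1 * inner ℝ u (g' x)‖ ≤ ε * ‖u‖ := by
      intro s hs
      rw [one_mul, ← inner_sub_right]
      refine (norm_inner_le_norm _ _).trans ?_
      rw [mul_comm]
      have := (hδ' hs.1 hs.2).le
      rw [dist_eq_norm] at this
      exact mul_le_mul_of_nonneg_right this (norm_nonneg _)
    have := Convex.norm_image_sub_le_of_norm_hasDerivWithin_le hd hb
      ((convex_Icc 0 1).inter (convex_ball x δ)) ⟨hx, Metric.mem_ball_self hδ⟩ hy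
    have e : inner ℝ u R =
        inner ℝ u (g y) - y * inner ℝ u (g' x) - (inner ℝ u (g x) - x * inner ℝ u (g' x)) := by
      rw [hR, inner_sub_right, inner_sub_right, real_inner_smul_right]
      ring
    rw [e]
    linarith
  have key2 : ‖inner ℝ R R‖ ≤ ε * ‖y - x‖ * ‖R‖ := by
    have hcl : IsClosed {u : H | ‖inner ℝ u R‖ ≤ ε * ‖y - x‖ * ‖u‖} :=
      isClosed_le (by fun_prop) (by fun_prop)
    have hmem : R ∈ V.topologicalClosure := hV ▸ Submodule.mem_top
    exact closure_minimal key hcl hmem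
  rw [real_inner_self_eq_norm_sq, Real.norm_eq_abs, abs_of_nonneg (sq_nonneg _)] at key2
  rcases eq_or_lt_of_le (norm_nonneg R) with h0 | h0
  · rw [← h0]; positivity
  · nlinarith

variable [CompleteSpace H]

/-- The feature map of a `C^{2k}` kernel is `k` times differentiable, and the inner products of
its derivatives are the mixed derivatives of the kernel. -/
theorem exists_featureMap_derivatives {K : ℝ → ℝ → ℝ} {ψ : ℝ → H} {k : ℕ} (hK : IsC2k k K)
    (hψ : ∀ x ∈ I01, ∀ y ∈ I01, inner ℝ (ψ x) (ψ y) = K x y)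
    (hV : (Submodule.span ℝ (ψ '' I01)).topologicalClosure = ⊤) :
    ∃ g : ℕ → ℝ → H,
      (∀ j ≤ k, ∀ x ∈ I01, ∀ y ∈ I01, inner ℝ (g j x) (g j y) = mixedDeriv j j K x y) ∧
      ∀ v : H, ∀ j ≤ k, ∀ x ∈ I01,
        iteratedDerivWithin j (fun s => inner ℝ v (ψ s)) I01 x = inner ℝ v (g j x) := by
  have hex : ∀ (j : ℕ) (x : ℝ), ∃ l : H, j ≤ k → x ∈ I01 →
      Tendsto (fun N => diffQuot j N ψ x) atTop (𝓝 l) := by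
    intro j x
    by_cases hj : j ≤ k
    swap
    · exact ⟨0, fun h => absurd h hj⟩
    by_cases hx : x ∈ I01
    swap
    · exact ⟨0, fun _ h => absurd h hx⟩
    -- Expanding the squared distance, all three inner products tend to the same mixed derivative.
    have hc : CauchySeq (fun N => diffQuot j N ψ x) := by
      rw [cauchySeq_iff_tendsto_dist_atTop_0]
      refine tendsto_zero_of_sq (fun _ => dist_nonneg) ?_
      simp_rw [dist_sq_eq_inner]
      have T := tendsto_inner_diffQuot hK hj hψ hx hx
      have p1 : Tendsto (fun p : ℕ × ℕ => (p.1, p.1)) atTop atTop := by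
        rw [← prod_atTop_atTop_eq]; exact tendsto_fst.prodMk tendsto_fst
      have p2 : Tendsto (fun p : ℕ × ℕ => (p.2, p.2)) atTop atTop := by
        rw [← prod_atTop_atTop_eq]; exact tendsto_snd.prodMk tendsto_snd
      have := ((T.comp p1).sub (T.const_mul 2)).add (T.comp p2)
      rw [show mixedDeriv j j K x x - 2 * mixedDeriv j j K x x + mixedDeriv j j K x x = 0 by ring]
        at this
      exact this
    obtain ⟨l, hl⟩ := cauchySeq_tendsto_of_complete hc
    exact ⟨l, fun _ _ => hl⟩
  choose g hg using hex
  have hgg : ∀ j ≤ k, ∀ x ∈ I01, ∀ y ∈ I01, inner ℝ (g j x) (g j y) = mixedDeriv j j K x y := by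
    intro j hj x hx y hy
    have pd : Tendsto (fun N : ℕ => (N, N)) atTop atTop := by
      rw [← prod_atTop_atTop_eq]; exact tendsto_id.prodMk tendsto_id
    have hlim := (tendsto_inner_diffQuot hK hj hψ hx hy).comp pd
    simp only [Function.comp_def] at hlim
    exact tendsto_nhds_unique ((hg j x hj hx).inner (hg j y hj hy)) hlim
  have hgψ : ∀ j ≤ k, ∀ x ∈ I01, ∀ y ∈ I01,
      inner ℝ (ψ y) (g j x) = iteratedDerivWithin j (fun t => K y t) I01 x := by
    intro j hj x hx y hy
    refine tendsto_nhds_unique ((tendsto_const_nhds (x := ψ y)).inner (hg j x hj hx)) ?_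
    refine (tendsto_diffQuot ((hK j hj).1 y hy) hx).congr fun N => ?_
    rw [inner_diffQuot]
    exact diffQuot_congr hx fun t ht => (hψ y hy t ht).symm
  have hspan : ∀ j < k, ∀ u ∈ Submodule.span ℝ (ψ '' I01), ∀ x ∈ I01,
      HasDerivWithinAt (fun s => inner ℝ u (g j s)) (inner ℝ u (g (j + 1) x)) I01 x := by
    intro j hj u hu x hx
    induction hu using Submodule.span_induction with
    | mem u hu =>
      obtain ⟨y, hy, rfl⟩ := hu
      rw [hgψ (j + 1) hj x hx y hy]
      exact (((hK k le_rfl).1 y hy).hasDerivWithinAt hj hx).congr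
        (fun s hs => hgψ j hj.le s hs y hy) (hgψ j hj.le x hx y hy)
    | zero => simpa using hasDerivWithinAt_const x I01 (0 : ℝ)
    | add u w _ _ hu hw =>
      simp only [inner_add_left]
      exact hu.fun_add hw
    | smul c u _ hu => simpa only [real_inner_smul_left] using hu.const_mul c
  have hderiv : ∀ j < k, ∀ x ∈ I01, HasDerivWithinAt (g j) (g (j + 1) x) I01 x := fun j hj x hx =>
    hasDerivWithinAt_of_inner_dense hV (continuousOn_of_inner (hK (j + 1) hj).2.2 (hgg (j + 1) hj))
      (hspan j hj) hx
  refine ⟨g, hgg, fun v j => ?_⟩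
  induction j with
  | zero =>
    intro _ x hx
    have : ψ x = g 0 x := by
      refine tendsto_nhds_unique ?_ (hg 0 x (Nat.zero_le _) hx)
      simp [diffQuot, diffBase]
    rw [iteratedDerivWithin_zero, this]
  | succ j ih =>
    intro hj x hx
    rw [iteratedDerivWithin_succ, derivWithin_congr (ih (by omega)) (ih (by omega) x hx)]
    have h1 : HasDerivWithinAt (fun s => inner ℝ v (g j s)) (inner ℝ v (g (j + 1) x)) I01 x := by
      simpa using (hasDerivWithinAt_const x I01 v).inner ℝ (hderiv j hj x hx)
    exact h1.derivWithin (uniqueDiffOn_Icc zero_lt_one x hx)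

end FeatureMap

/-! ### Diagonal operators and tensor squares on ℓ² -/

theorem hasSum_of_forall_eq {ι : Type*} {f g : ι → ℝ} {s : ℝ} (hf : HasSum f s)
    (h : ∀ i, f i = g i) : HasSum g s := funext h ▸ hf

/-- The space of square summable real families. -/
abbrev SqSummable (ι : Type*) : Type _ := lp (fun _ : ι => ℝ) 2

namespace SqSummable

variable {ι : Type*}

/-- A square summable family as an element of `ℓ²`. -/
def mk (f : ι → ℝ) (hf : Summable fun i => f i ^ 2) : SqSummable ι :=
  ⟨f, memℓp_gen (by simpa using hf)⟩

@[simp] theorem mk_apply (f : ι → ℝ) (hf : Summable fun i => f i ^ 2) (i : ι) : mk f hf i = f i :=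
  rfl

theorem hasSum_inner (f g : SqSummable ι) : HasSum (fun i => f i * g i) (inner ℝ f g) := by
  simpa [mul_comm] using lp.hasSum_inner (𝕜 := ℝ) f g

theorem hasSum_sq (f : SqSummable ι) : HasSum (fun i => f i ^ 2) (‖f‖ ^ 2) := by
  rw [← real_inner_self_eq_norm_sq]
  simpa only [sq] using hasSum_inner f f

theorem inner_single_one [DecidableEq ι] (i : ι) (f : SqSummable ι) :
    inner ℝ (lp.single 2 i (1 : ℝ) : SqSummable ι) f = f i := by
  rw [lp.inner_single_left]
  simp

/-- Multiplication by a bounded family. -/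
noncomputable def diagOp (c : ι → ℝ) (C : ℝ) (hc : ∀ i, |c i| ≤ C) :
    SqSummable ι →L[ℝ] SqSummable ι :=
  have hle : ∀ (f : SqSummable ι) (i : ι), (c i * f i) ^ 2 ≤ C ^ 2 * f i ^ 2 := fun f i => by
    rw [mul_pow]
    exact mul_le_mul_of_nonneg_right (sq_le_sq' (abs_le.1 (hc i)).1 (abs_le.1 (hc i)).2)
      (sq_nonneg _)
  have hsum : ∀ f : SqSummable ι, Summable fun i => (c i * f i) ^ 2 := fun f =>
    Summable.of_nonneg_of_le (fun _ => sq_nonneg _) (hle f) ((hasSum_sq f).summable.mul_left _)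
  LinearMap.mkContinuous
    { toFun := fun f => mk (fun i => c i * f i) (hsum f)
      map_add' := fun f g => by ext i; simp [mul_add]
      map_smul' := fun a f => by ext i; simp [mul_left_comm] } |C| fun f => by
    refine abs_le_of_sq_le_sq' ?_ (by positivity) |>.2
    rw [mul_pow, sq_abs]
    exact hasSum_le (hle f) (hasSum_sq _) ((hasSum_sq f).mul_left _)

@[simp] theorem diagOp_apply (c : ι → ℝ) (C : ℝ) (hc : ∀ i, |c i| ≤ C) (f : SqSummable ι) (i : ι) :
    diagOp c C hc f i = c i * f i := rfl

/-- The tensor square of an element of `ℓ²`. -/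
noncomputable def tensorSq (f : SqSummable ι) : SqSummable (ι × ι) :=
  mk (fun p => f p.1 * f p.2) (by
    simp_rw [mul_pow]
    exact (hasSum_sq f).summable.mul_of_nonneg (hasSum_sq f).summable
      (fun _ => sq_nonneg _) (fun _ => sq_nonneg _))

@[simp] theorem tensorSq_apply (f : SqSummable ι) (p : ι × ι) : tensorSq f p = f p.1 * f p.2 := rfl

/-- Turns quadratic forms into linear functionals, so that Cauchy–Schwarz in ℓ²(ι × ι) is the bound
of the operator norm by the Hilbert–Schmidt norm. -/
theorem inner_tensorSq (f g : SqSummable ι) :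
    inner ℝ (tensorSq f) (tensorSq g) = inner ℝ f g ^ 2 := by
  have h1 := hasSum_inner (tensorSq f) (tensorSq g)
  have h2 := hasSum_inner f g
  have h3 : (fun p : ι × ι => tensorSq f p * tensorSq g p) =
      fun p => (f p.1 * g p.1) * (f p.2 * g p.2) := by
    ext p; simp only [tensorSq_apply]; ring
  rw [h3] at h1
  rw [sq, h2.mul_eq h2 h1]

theorem norm_tensorSq (f : SqSummable ι) : ‖tensorSq f‖ = ‖f‖ ^ 2 := by
  have h := inner_tensorSq f f
  rw [real_inner_self_eq_norm_sq, real_inner_self_eq_norm_sq] at h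
  exact (pow_left_inj₀ (norm_nonneg _) (sq_nonneg _) two_ne_zero).1 h

theorem inner_diagonal_tensorSq [DecidableEq ι] {M : SqSummable (ι × ι)} {d : ι → ℝ}
    (hM : ∀ i j, M (i, j) = if i = j then d i else 0) (f : SqSummable ι) :
    HasSum (fun i => d i * f i ^ 2) (inner ℝ M (tensorSq f)) := by
  have h := hasSum_inner M (tensorSq f)
  have hinj : Function.Injective (fun i : ι => (i, i)) := fun i j h => (Prod.mk.inj h).1
  rw [← hinj.hasSum_iff] at h
  · refine hasSum_of_forall_eq h fun i => ?_
    simp [hM, sq]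
  · rintro ⟨i, j⟩ hp
    have : i ≠ j := fun h => hp ⟨i, by simp [h]⟩
    simp [hM, this]

end SqSummable

open SqSummable

/-! ### Ridge regression in feature space -/

open scoped Matrix in
theorem isUnit_det_gram_add {H : Type*} [NormedAddCommGroup H] [InnerProductSpace ℝ H] {n : ℕ}
    (p : Fin n → H) {c : ℝ} (hc : 0 < c) :
    IsUnit (Matrix.of (fun i j => inner ℝ (p i) (p j)) + c • (1 : Matrix (Fin n) (Fin n) ℝ)).det := by
  have h1 : (Matrix.of (fun i j => inner ℝ (p i) (p j))).PosSemidef := Matrix.posSemidef_gram ℝ p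
  have h2 : (c • (1 : Matrix (Fin n) (Fin n) ℝ)).PosDef := Matrix.PosDef.one.smul hc
  exact (h2.posSemidef_add h1).det_pos.ne'.isUnit

open scoped Matrix in
/-- The residual of kernel ridge regression in feature space. -/
theorem exists_ridge_residual {H : Type*} [NormedAddCommGroup H] [InnerProductSpace ℝ H] {n : ℕ}
    (p : Fin n → H) (g : H) {c : ℝ} (hc : 0 < c) :
    ∃ r : H, inner ℝ g r = inner ℝ g g - (fun i => inner ℝ (p i) g) ⬝ᵥ
        ((Matrix.of (fun i j => inner ℝ (p i) (p j)) + c • (1 : Matrix (Fin n) (Fin n) ℝ))⁻¹ *ᵥ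
          fun i => inner ℝ (p i) g) ∧
      c * inner ℝ g r = c * ‖r‖ ^ 2 + ∑ a, inner ℝ (p a) r ^ 2 := by
  set G := Matrix.of (fun i j => inner ℝ (p i) (p j)) + c • (1 : Matrix (Fin n) (Fin n) ℝ) with hG
  set b : Fin n → ℝ := fun i => inner ℝ (p i) g with hb
  set α := G⁻¹ *ᵥ b with hα
  have hGα : G *ᵥ α = b := by
    rw [hα, Matrix.mulVec_mulVec, Matrix.mul_nonsing_inv _ (isUnit_det_gram_add p hc),
      Matrix.one_mulVec]
  have hGa : ∀ a, ∑ i, inner ℝ (p a) (p i) * α i + c * α a = b a := fun a => by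
    rw [← congrFun hGα a, hG, Matrix.add_mulVec, Matrix.smul_mulVec, Matrix.one_mulVec]
    rfl
  set r := g - ∑ i, α i • p i with hr
  -- The normal equations: the residual's products with the design vectors are `c` times the ridge
  -- coefficients.
  have hpr : ∀ a, inner ℝ (p a) r = c * α a := fun a => by
    have : inner ℝ (p a) r = b a - ∑ i, inner ℝ (p a) (p i) * α i := by
      simp only [hr, inner_sub_right, inner_sum, real_inner_smul_right, hb, mul_comm]
    linarith [hGa a]
  have hgr : inner ℝ g r = ‖r‖ ^ 2 + ∑ i, α i * (c * α i) := by
    have hg : g = r + ∑ i, α i • p i := by rw [hr]; abel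
    conv_lhs => rw [hg]
    rw [inner_add_left, real_inner_self_eq_norm_sq, sum_inner]
    simp only [real_inner_smul_left, hpr]
  refine ⟨r, ?_, ?_⟩
  · rw [hr, inner_sub_right, inner_sum, dotProduct]
    simp only [real_inner_smul_right, hb, mul_comm, real_inner_comm]
  · rw [hgr, mul_add, Finset.mul_sum]
    congr 1
    refine Finset.sum_congr rfl fun i _ => ?_
    rw [hpr]
    ring

/-- If the empirical second moment operator is close to the population one in the whitened
Hilbert–Schmidt norm, then the ridge residual is controlled by the population resolvent. -/
theorem ridge_form_le {n : ℕ} {lam : ℝ} (hlam : 0 < lam) {μ : ℕ → ℝ}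
    (hμ : ∀ i, 0 < μ i) {w : ℕ → ℝ} (hw : ∀ i, w i = (Real.sqrt (lam + μ i))⁻¹) {C C' : ℝ}
    (hwC : ∀ i, |w i| ≤ C) (hsC : ∀ i, |Real.sqrt (lam + μ i)| ≤ C')
    (p : Fin n → SqSummable ℕ) (g r : SqSummable ℕ) {M : SqSummable (ℕ × ℕ)}
    (hM : ∀ i j, M (i, j) = if i = j then μ i / (lam + μ i) else 0)
    (hr : (n * lam) * inner ℝ g r = (n * lam) * ‖r‖ ^ 2 + ∑ a, inner ℝ (p a) r ^ 2)
    (hn : 0 < n)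
    (hS : ‖∑ a, (tensorSq (diagOp w C hwC (p a)) - M)‖ ≤ n * (1 / 2)) :
    0 ≤ inner ℝ g r ∧ inner ℝ g r ≤ 2 * lam * ‖diagOp w C hwC g‖ ^ 2 := by
  have hn' : (0 : ℝ) < n := by exact_mod_cast hn
  -- `u = (Σ + λ)^{1/2} r` is dual to the whitening by `w`, so pairings with `r` become pairings of
  -- whitened vectors with `u`.
  set u := diagOp (fun i => Real.sqrt (lam + μ i)) C' hsC r with hu
  have hpos : ∀ i, 0 < lam + μ i := fun i => add_pos hlam (hμ i)
  have hinner : ∀ f : SqSummable ℕ, inner ℝ (diagOp w C hwC f) u = inner ℝ f r := by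
    intro f
    refine (hasSum_inner (diagOp w C hwC f) u).unique ?_
    refine hasSum_of_forall_eq (hasSum_inner f r) fun i => ?_
    have hi := (Real.sqrt_pos.2 (hpos i)).ne'
    rw [hu, diagOp_apply, diagOp_apply, hw]
    field_simp
  have hu2 : ‖u‖ ^ 2 = lam * ‖r‖ ^ 2 + inner ℝ M (tensorSq u) := by
    refine (hasSum_sq u).unique ?_
    have := ((hasSum_sq r).mul_left lam).add (inner_diagonal_tensorSq hM u)
    refine hasSum_of_forall_eq this fun i => ?_
    have hi := hpos i
    rw [hu, diagOp_apply, mul_pow, Real.sq_sqrt hi.le]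
    field_simp
  have hcs := abs_le.1 (abs_real_inner_le_norm (∑ a, (tensorSq (diagOp w C hwC (p a)) - M)) (tensorSq u))
  rw [norm_tensorSq] at hcs
  have hexp : inner ℝ (∑ a, (tensorSq (diagOp w C hwC (p a)) - M)) (tensorSq u) =
      ∑ a, inner ℝ (p a) r ^ 2 - n * inner ℝ M (tensorSq u) := by
    rw [sum_inner]
    simp only [inner_sub_left, inner_tensorSq, hinner, Finset.sum_sub_distrib, Finset.sum_const,
      Finset.card_univ, Fintype.card_fin, nsmul_eq_mul]
  have hle := mul_le_mul_of_nonneg_right hS (sq_nonneg ‖u‖)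
  have hQ0 : 0 ≤ inner ℝ g r := by
    have : 0 ≤ (n * lam) * inner ℝ g r := by
      rw [hr]
      exact add_nonneg (by positivity) (Finset.sum_nonneg fun _ _ => sq_nonneg _)
    exact nonneg_of_mul_nonneg_right this (by positivity)
  -- By `hr`, `nλ⟨g, r⟩` is the empirical form at `r`. It differs from the population form `n‖u‖²`
  -- by at most `n‖u‖²/2`.
  have hu3 : ‖u‖ ^ 2 ≤ 2 * lam * inner ℝ g r := by
    have : n * ‖u‖ ^ 2 ≤ n * (2 * lam * inner ℝ g r) := by
      have e : n * ‖u‖ ^ 2 = n * lam * ‖r‖ ^ 2 + n * inner ℝ M (tensorSq u) := by rw [hu2]; ring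
      rw [hexp] at hcs
      nlinarith [hcs.1]
    exact le_of_mul_le_mul_left this hn'
  refine ⟨hQ0, ?_⟩
  have hcs2 := real_inner_le_norm (diagOp w C hwC g) u
  rw [hinner] at hcs2
  have hsq : inner ℝ g r ^ 2 ≤ ‖diagOp w C hwC g‖ ^ 2 * (2 * lam * inner ℝ g r) := by
    calc inner ℝ g r ^ 2 ≤ (‖diagOp w C hwC g‖ * ‖u‖) ^ 2 := by gcongr
      _ = ‖diagOp w C hwC g‖ ^ 2 * ‖u‖ ^ 2 := mul_pow _ _ _
      _ ≤ _ := by gcongr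
  rcases eq_or_lt_of_le hQ0 with h0 | h0
  · rw [← h0]; positivity
  · refine le_of_mul_le_mul_right ?_ h0
    nlinarith

open SqSummable

theorem SqSummable.continuous_tensorSq {ι : Type*} :
    Continuous (tensorSq : SqSummable ι → SqSummable (ι × ι)) := by
  rw [continuous_iff_continuousAt]
  intro f
  rw [ContinuousAt, tendsto_iff_dist_tendsto_zero]
  refine tendsto_zero_of_sq (fun _ => dist_nonneg) ?_
  simp only [dist_sq_eq_inner, inner_tensorSq]
  have hc : Continuous fun g : SqSummable ι =>
      (inner ℝ g g ^ 2 - 2 * inner ℝ g f ^ 2 + inner ℝ f f ^ 2 : ℝ) := by fun_prop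
  have h0 := hc.tendsto f
  rwa [show (inner ℝ f f ^ 2 - 2 * inner ℝ f f ^ 2 + inner ℝ f f ^ 2 : ℝ) = 0 by ring] at h0

/-! ### The Mercer feature map and its second moment -/

section Mercer

variable {PX : Measure ℝ} {K : ℝ → ℝ → ℝ} {μ : ℕ → ℝ} {φ : ℕ → ℝ → ℝ}

/-- The Mercer feature map `x ↦ (√μ_i φ_i(x))_i`, extended continuously to the line. -/
theorem IsMercerSystem.exists_featureMap (hm : IsMercerSystem PX K μ φ)
    (hK : ContinuousOn (fun p : ℝ × ℝ => K p.1 p.2) (I01 ×ˢ I01)) :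
    ∃ ψ : ℝ → SqSummable ℕ, Continuous ψ ∧ (∀ x, ∃ y ∈ I01, ψ x = ψ y) ∧
      (∀ x ∈ I01, ∀ i, ψ x i = Real.sqrt (μ i) * φ i x) ∧
      ∀ x ∈ I01, ∀ y ∈ I01, inner ℝ (ψ x) (ψ y) = K x y := by
  -- Clamping to the unit interval makes `ψ` continuous, and hence measurable and bounded, on the
  -- whole line.
  set q : ℝ → ℝ := fun x => (projIcc (0 : ℝ) 1 zero_le_one x : ℝ) with hq
  have hqm : ∀ x, q x ∈ I01 := fun x => (projIcc (0 : ℝ) 1 zero_le_one x).2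
  have hqx : ∀ x ∈ I01, q x = x := fun x hx => by simp [hq, projIcc_of_mem zero_le_one hx]
  have hmul : ∀ x y i, (Real.sqrt (μ i) * φ i x) * (Real.sqrt (μ i) * φ i y) =
      μ i * φ i x * φ i y := fun x y i => by
    linear_combination (φ i x * φ i y) * Real.mul_self_sqrt (hm.pos i).le
  have hsum : ∀ x, Summable fun i => (Real.sqrt (μ i) * φ i (q x)) ^ 2 := fun x => by
    simp only [sq, hmul]
    exact (hm.expansion _ (hqm x) _ (hqm x)).summable
  set ψ : ℝ → SqSummable ℕ := fun x => SqSummable.mk _ (hsum x) with hψ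
  have hval : ∀ x ∈ I01, ∀ i, ψ x i = Real.sqrt (μ i) * φ i x := fun x hx i => by
    rw [hψ, SqSummable.mk_apply, hqx x hx]
  have hinner : ∀ x ∈ I01, ∀ y ∈ I01, inner ℝ (ψ x) (ψ y) = K x y := fun x hx y hy => by
    refine (SqSummable.hasSum_inner _ _).unique ?_
    refine hasSum_of_forall_eq (hm.expansion x hx y hy) fun i => ?_
    rw [hval x hx, hval y hy, hmul]
  have hψq : ∀ x, ψ x = ψ (q x) := fun x => by
    ext i
    simp only [hψ, SqSummable.mk_apply, hqx _ (hqm x)]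
  have hc : Continuous fun x => ψ (q x) :=
    (continuousOn_of_inner hK hinner).comp_continuous
      (continuous_subtype_val.comp continuous_projIcc) hqm
  exact ⟨ψ, hc.congr fun x => (hψq x).symm, fun x => ⟨q x, hqm x, hψq x⟩, hval, hinner⟩

theorem IsMercerSystem.integral_mul (hm : IsMercerSystem PX K μ φ) (i j : ℕ) :
    ∫ y, φ i y * φ j y ∂PX = if i = j then 1 else 0 := by
  obtain ⟨b, hb⟩ := hm.basis
  have h := (orthonormal_iff_ite.1 b.orthonormal) j i
  rw [L2.inner_def] at h
  rw [show (if i = j then (1 : ℝ) else 0) = if j = i then 1 else 0 by simp [eq_comm], ← h]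
  refine integral_congr_ae ?_
  filter_upwards [hb i, hb j] with y hi hj
  simp [hi, hj]

variable [IsProbabilityMeasure PX]

theorem IsMercerSystem.integrable (hm : IsMercerSystem PX K μ φ) (i : ℕ) :
    Integrable (φ i) PX := by
  obtain ⟨b, hb⟩ := hm.basis
  exact ((Lp.memLp (b i)).integrable one_le_two).congr (hb i)

theorem exists_norm_le_of_forall_exists {E : Type*} [SeminormedAddCommGroup E] {ψ : ℝ → E}
    (hc : Continuous ψ) (hψ : ∀ x, ∃ y ∈ I01, ψ x = ψ y) : ∃ B, ∀ x, ‖ψ x‖ ≤ B := by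
  obtain ⟨B, hB⟩ := (isCompact_Icc (a := (0 : ℝ)) (b := 1)).exists_bound_of_continuousOn
    hc.continuousOn
  refine ⟨B, fun x => ?_⟩
  obtain ⟨y, hy, he⟩ := hψ x
  rw [he]
  exact hB y hy

/-- A vector orthogonal to every `ψ y` is orthogonal to `∫ φ_j ψ dPX = √μ_j e_j`, and `μ_j > 0`. -/
theorem IsMercerSystem.dense_span (hm : IsMercerSystem PX K μ φ) (hsupp : PX I01ᶜ = 0)
    {ψ : ℝ → SqSummable ℕ} (hc : Continuous ψ) (hψ : ∀ x, ∃ y ∈ I01, ψ x = ψ y)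
    (hval : ∀ x ∈ I01, ∀ i, ψ x i = Real.sqrt (μ i) * φ i x) :
    (Submodule.span ℝ (ψ '' I01)).topologicalClosure = ⊤ := by
  rw [Submodule.topologicalClosure_eq_top_iff, Submodule.eq_bot_iff]
  intro a ha
  have ha' : ∀ y ∈ I01, inner ℝ a (ψ y) = 0 := fun y hy =>
    (Submodule.mem_orthogonal' _ _).1 ha _ (Submodule.subset_span (mem_image_of_mem ψ hy))
  have hae : ∀ᵐ y ∂PX, y ∈ I01 := hsupp
  obtain ⟨B, hB⟩ := exists_norm_le_of_forall_exists hc hψ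
  have hint : ∀ j, Integrable (fun y => φ j y • ψ y) PX := fun j => by
    refine ((hm.integrable j).norm.mul_const B).mono'
      ((hm.integrable j).aestronglyMeasurable.smul hc.aestronglyMeasurable)
      (ae_of_all _ fun y => ?_)
    rw [norm_smul]
    exact mul_le_mul_of_nonneg_left (hB y) (norm_nonneg _)
  ext j
  have h1 : ∫ y, φ j y • ψ y ∂PX = lp.single 2 j (Real.sqrt (μ j)) := by
    ext i
    rw [← SqSummable.inner_single_one i (∫ y, φ j y • ψ y ∂PX), ← integral_inner (hint j)]
    have : ∫ y, inner ℝ (lp.single 2 i (1 : ℝ) : SqSummable ℕ) (φ j y • ψ y) ∂PX =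
        ∫ y, Real.sqrt (μ i) * (φ i y * φ j y) ∂PX := by
      refine integral_congr_ae ?_
      filter_upwards [hae] with y hy
      rw [real_inner_smul_right, SqSummable.inner_single_one, hval y hy]
      ring
    rw [this, integral_const_mul, hm.integral_mul, lp.single_apply]
    by_cases hij : i = j
    · subst hij; simp
    · simp [hij]
  have h2 : ∫ y, inner ℝ a (φ j y • ψ y) ∂PX = 0 := by
    refine integral_eq_zero_of_ae ?_
    filter_upwards [hae] with y hy
    rw [real_inner_smul_right, ha' y hy, mul_zero]
    rfl
  rw [integral_inner (hint j), h1, lp.inner_single_right] at h2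
  have h3 : Real.sqrt (μ j) ≠ 0 := (Real.sqrt_pos.2 (hm.pos j)).ne'
  simpa [h3] using h2

theorem IsMercerSystem.integral_tensorSq_apply (hm : IsMercerSystem PX K μ φ)
    (hsupp : PX I01ᶜ = 0) {ψ : ℝ → SqSummable ℕ} (hc : Continuous ψ)
    (hψ : ∀ x, ∃ y ∈ I01, ψ x = ψ y)
    (hval : ∀ x ∈ I01, ∀ i, ψ x i = Real.sqrt (μ i) * φ i x) {lam : ℝ} (hlam : 0 < lam) {w : ℕ → ℝ}
    (hw : ∀ i, w i = (Real.sqrt (lam + μ i))⁻¹) {C : ℝ} (hwC : ∀ i, |w i| ≤ C) (i j : ℕ) :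
    (∫ y, tensorSq (diagOp w C hwC (ψ y)) ∂PX : SqSummable (ℕ × ℕ)) (i, j) =
      if i = j then μ i / (lam + μ i) else 0 := by
  have hae : ∀ᵐ y ∂PX, y ∈ I01 := hsupp
  have hZc : Continuous fun y => tensorSq (diagOp w C hwC (ψ y)) :=
    SqSummable.continuous_tensorSq.comp ((diagOp w C hwC).continuous.comp hc)
  obtain ⟨B, hB⟩ := exists_norm_le_of_forall_exists hZc fun x => by
    obtain ⟨y, hy, he⟩ := hψ x
    exact ⟨y, hy, by rw [he]⟩
  have hint : Integrable (fun y => tensorSq (diagOp w C hwC (ψ y))) PX :=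
    Integrable.of_bound hZc.aestronglyMeasurable B (ae_of_all _ hB)
  rw [← SqSummable.inner_single_one (i, j) (∫ y, tensorSq (diagOp w C hwC (ψ y)) ∂PX),
    ← integral_inner hint]
  have : ∫ y, inner ℝ (lp.single 2 (i, j) (1 : ℝ) : SqSummable (ℕ × ℕ))
        (tensorSq (diagOp w C hwC (ψ y))) ∂PX =
      ∫ y, (w i * Real.sqrt (μ i) * (w j * Real.sqrt (μ j))) * (φ i y * φ j y) ∂PX := by
    refine integral_congr_ae ?_
    filter_upwards [hae] with y hy
    rw [SqSummable.inner_single_one, tensorSq_apply, diagOp_apply, diagOp_apply, hval y hy,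
      hval y hy]
    ring
  rw [this, integral_const_mul, hm.integral_mul]
  by_cases hij : i = j
  · subst hij
    have hpos : 0 < lam + μ i := add_pos hlam (hm.pos i)
    have e : w i * Real.sqrt (μ i) * (w i * Real.sqrt (μ i)) = w i ^ 2 * Real.sqrt (μ i) ^ 2 := by
      ring
    rw [e, hw, inv_pow, Real.sq_sqrt hpos.le, Real.sq_sqrt (hm.pos i).le]
    simp only [if_true]
    field_simp
  · simp [hij]

end Mercer

/-! ### Effective dimension and the deterministic variance bound -/

section Effective

variable {k : ℕ} {K : ℝ → ℝ → ℝ} {μ : ℕ → ℝ} {φ : ℕ → ℝ → ℝ} {ψ : ℝ → SqSummable ℕ}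
  {g : ℕ → ℝ → SqSummable ℕ}

theorem norm_diagOp_sq_le_kappaSq (hK : IsC2k k K) (hμ : ∀ i, 0 < μ i)
    (hval : ∀ x ∈ I01, ∀ i, ψ x i = Real.sqrt (μ i) * φ i x)
    (hgg : ∀ j ≤ k, ∀ x ∈ I01, ∀ y ∈ I01, inner ℝ (g j x) (g j y) = mixedDeriv j j K x y)
    (hg : ∀ v : SqSummable ℕ, ∀ j ≤ k, ∀ x ∈ I01,
      iteratedDerivWithin j (fun s => inner ℝ v (ψ s)) I01 x = inner ℝ v (g j x))
    {lam : ℝ} (hlam : 0 < lam) {w : ℕ → ℝ} (hw : ∀ i, w i = (Real.sqrt (lam + μ i))⁻¹) {C : ℝ}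
    (hwC : ∀ i, |w i| ≤ C) {j : ℕ} (hj : j ≤ k) {x : ℝ} (hx : x ∈ I01) :
    ‖diagOp w C hwC (g j x)‖ ^ 2 ≤ kappaSq μ φ lam j := by
  have hsum : ∀ x ∈ I01, ∑' i, μ i / (lam + μ i) * (iteratedDerivWithin j (φ i) I01 x) ^ 2 =
      ‖diagOp w C hwC (g j x)‖ ^ 2 := by
    intro x hx
    refine HasSum.tsum_eq (hasSum_of_forall_eq (SqSummable.hasSum_sq _) fun i => ?_)
    have hs := (Real.sqrt_pos.2 (hμ i)).ne'
    -- `φ_i` is a multiple of a coordinate of `ψ`, so its derivatives are read off the coordinates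
    -- of `g j`.
    have hd : iteratedDerivWithin j (φ i) I01 x = (Real.sqrt (μ i))⁻¹ * g j x i := by
      rw [← SqSummable.inner_single_one i (g j x), ← real_inner_smul_left, ← hg _ j hj x hx]
      refine iteratedDerivWithin_congr (fun s hs' => ?_) hx
      rw [real_inner_smul_left, SqSummable.inner_single_one, hval s hs',
        inv_mul_cancel_left₀ hs]
    rw [hd, diagOp_apply, hw, mul_pow, mul_pow, inv_pow, inv_pow, Real.sq_sqrt (hμ i).le,
      Real.sq_sqrt (add_pos hlam (hμ i)).le]
    have := hμ i
    have := add_pos hlam (hμ i)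
    field_simp
  have hcont : ContinuousOn (fun x => ‖diagOp w C hwC (g j x)‖ ^ 2) I01 :=
    (((diagOp w C hwC).continuous.comp_continuousOn
      (continuousOn_of_inner (hK j hj).2.2 (hgg j hj))).norm).pow 2
  obtain ⟨B, hB⟩ := isCompact_Icc.bddAbove_image hcont
  -- Needed because the real supremum of an unbounded family is 0 by convention.
  have hbdd : BddAbove (range fun x : I01 =>
      ∑' i, μ i / (lam + μ i) * (iteratedDerivWithin j (φ i) I01 (x : ℝ)) ^ 2) := by
    refine ⟨B, ?_⟩
    rintro _ ⟨x, rfl⟩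
    simp only [hsum x x.2]
    exact hB (mem_image_of_mem _ x.2)
  rw [← hsum x hx]
  exact le_ciSup hbdd (⟨x, hx⟩ : I01)

theorem abs_plugInCov_le (hK : IsC2k k K) (hμ : ∀ i, 0 < μ i) {C' : ℝ}
    (hψ : ∀ x ∈ I01, ∀ y ∈ I01, inner ℝ (ψ x) (ψ y) = K x y)
    (hval : ∀ x ∈ I01, ∀ i, ψ x i = Real.sqrt (μ i) * φ i x)
    (hgg : ∀ j ≤ k, ∀ x ∈ I01, ∀ y ∈ I01, inner ℝ (g j x) (g j y) = mixedDeriv j j K x y)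
    (hg : ∀ v : SqSummable ℕ, ∀ j ≤ k, ∀ x ∈ I01,
      iteratedDerivWithin j (fun s => inner ℝ v (ψ s)) I01 x = inner ℝ v (g j x))
    {lam : ℝ} (hlam : 0 < lam) {w : ℕ → ℝ} (hw : ∀ i, w i = (Real.sqrt (lam + μ i))⁻¹) {C : ℝ}
    (hwC : ∀ i, |w i| ≤ C) (hsC : ∀ i, |Real.sqrt (lam + μ i)| ≤ C') {M : SqSummable (ℕ × ℕ)}
    (hM : ∀ i j, M (i, j) = if i = j then μ i / (lam + μ i) else 0)
    (σ : ℝ) {n : ℕ} (hn : 0 < n) {X : Fin n → ℝ} (hX : ∀ a, X a ∈ I01)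
    (hS : ‖∑ a, (tensorSq (diagOp w C hwC (ψ (X a))) - M)‖ ≤ n * (1 / 2)) {x : ℝ} (hx : x ∈ I01) :
    |plugInCov k K σ lam X x x| ≤ 2 * σ ^ 2 * kappaSq μ φ lam k / n := by
  have hn' : (0 : ℝ) < n := by exact_mod_cast hn
  obtain ⟨r, hr1, hr2⟩ := exists_ridge_residual (fun a => ψ (X a)) (g k x)
    (mul_pos hn' hlam)
  obtain ⟨h0, h1⟩ := ridge_form_le hlam hμ hw hwC hsC (fun a => ψ (X a)) (g k x) r hM hr2 hn hS
  have hκ := norm_diagOp_sq_le_kappaSq hK hμ hval hgg hg hlam hw hwC le_rfl hx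
  have e1 : ∀ a, mixedDeriv k 0 K x (X a) = inner ℝ (ψ (X a)) (g k x) := fun a => by
    rw [← hg _ k le_rfl x hx, mixedDeriv]
    refine iteratedDerivWithin_congr (fun s hs => ?_) hx
    rw [iteratedDerivWithin_zero, real_inner_comm, hψ s hs _ (hX a)]
  have e2 : ∀ a, mixedDeriv 0 k K (X a) x = inner ℝ (ψ (X a)) (g k x) := fun a => by
    rw [← hg _ k le_rfl x hx, mixedDeriv, iteratedDerivWithin_zero]
    exact iteratedDerivWithin_congr (fun s hs => (hψ _ (hX a) s hs).symm) hx
  have e3 : plugInCov k K σ lam X x x = σ ^ 2 * ((n : ℝ) * lam)⁻¹ * inner ℝ (g k x) r := by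
    rw [hr1, plugInCov]
    simp only [e1, e2, hgg k le_rfl x hx x hx, hψ _ (hX _) _ (hX _)]
  have hc : 0 ≤ σ ^ 2 * ((n : ℝ) * lam)⁻¹ := by positivity
  rw [e3, abs_of_nonneg (mul_nonneg hc h0)]
  calc σ ^ 2 * ((n : ℝ) * lam)⁻¹ * inner ℝ (g k x) r
      ≤ σ ^ 2 * ((n : ℝ) * lam)⁻¹ * (2 * lam * kappaSq μ φ lam k) := by
        refine mul_le_mul_of_nonneg_left (h1.trans ?_) hc
        exact mul_le_mul_of_nonneg_left hκ (by positivity)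
    _ = _ := by field_simp

end Effective

/-! ### From the law of the data to the law of the design -/

section DataLaw

variable {PX : Measure ℝ} [IsProbabilityMeasure PX] {f₀ : ℝ → ℝ} (σ : ℝ)

omit [IsProbabilityMeasure PX] in
theorem aemeasurable_obs (hsupp : PX I01ᶜ = 0) (hf₀ : ContinuousOn f₀ I01) :
    AEMeasurable (fun p : ℝ × ℝ => (p.1, f₀ p.1 + p.2))
      (PX.prod (gaussianReal 0 (Real.toNNReal (σ ^ 2)))) := by
  have hf : AEMeasurable f₀ PX := by
    have h := hf₀.aemeasurable (μ := PX) measurableSet_Icc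
    have hae : ∀ᵐ x ∂PX, x ∈ I01 := hsupp
    rwa [Measure.restrict_eq_self_of_ae_mem hae] at h
  exact measurable_fst.aemeasurable.prodMk
    ((hf.comp_quasiMeasurePreserving Measure.quasiMeasurePreserving_fst).add
      measurable_snd.aemeasurable)

theorem map_fst_obsLaw (hsupp : PX I01ᶜ = 0) (hf₀ : ContinuousOn f₀ I01) :
    (obsLaw PX f₀ σ).map Prod.fst = PX := by
  rw [obsLaw, AEMeasurable.map_map_of_aemeasurable measurable_fst.aemeasurable
    (aemeasurable_obs σ hsupp hf₀)]
  have : (Prod.fst ∘ fun p : ℝ × ℝ => (p.1, f₀ p.1 + p.2)) = Prod.fst := rfl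
  rw [this, Measure.map_fst_prod, measure_univ, one_smul]

theorem isProbabilityMeasure_obsLaw (hsupp : PX I01ᶜ = 0) (hf₀ : ContinuousOn f₀ I01) :
    IsProbabilityMeasure (obsLaw PX f₀ σ) :=
  Measure.isProbabilityMeasure_map (aemeasurable_obs σ hsupp hf₀)

/-- A property of the design that holds with probability at least `1 - δ` under i.i.d. sampling
from `PX` holds with probability at least `1 - δ` under the law of the data. -/
theorem one_sub_le_dataLaw (hsupp : PX I01ᶜ = 0) (hf₀ : ContinuousOn f₀ I01) {n : ℕ} {δ : ℝ}
    {bad : Set (Fin n → ℝ)} (hbad : (Measure.pi fun _ : Fin n => PX).real bad ≤ δ)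
    {good : Set (Fin n → ℝ × ℝ)}
    (h : ∀ D : Fin n → ℝ × ℝ, (∀ a, (D a).1 ∈ I01) → (fun a => (D a).1) ∉ bad → D ∈ good) :
    1 - δ ≤ (dataLaw PX f₀ σ n).real good := by
  have := isProbabilityMeasure_obsLaw σ hsupp hf₀
  have : IsProbabilityMeasure (dataLaw PX f₀ σ n) := by unfold dataLaw; infer_instance
  have hmap : (dataLaw PX f₀ σ n).map (fun D a => (D a).1) = Measure.pi fun _ : Fin n => PX := by
    have hp : ∀ _ : Fin n, SigmaFinite ((obsLaw PX f₀ σ).map Prod.fst) := fun _ => by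
      rw [map_fst_obsLaw σ hsupp hf₀]; infer_instance
    have h := Measure.pi_map_pi (μ := fun _ : Fin n => obsLaw PX f₀ σ)
      (f := fun _ => Prod.fst) (fun _ => measurable_fst.aemeasurable)
    simp only [map_fst_obsLaw σ hsupp hf₀] at h
    exact h
  have hmeas : Measurable fun (D : Fin n → ℝ × ℝ) (a : Fin n) => (D a).1 := by fun_prop
  have hout : (Measure.pi fun _ : Fin n => PX) {X | ¬ ∀ a, X a ∈ I01} = 0 := by
    have : ∀ᵐ X ∂(Measure.pi fun _ : Fin n => PX), ∀ a, X a ∈ I01 :=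
      ae_all_iff.2 fun a =>
        (Measure.quasiMeasurePreserving_eval (fun _ : Fin n => PX) a).ae hsupp
    exact this
  -- An inequality valid for arbitrary sets, so no event has to be shown measurable.
  have hle : ∀ s : Set (Fin n → ℝ), (dataLaw PX f₀ σ n).real ((fun D a => (D a).1) ⁻¹' s) ≤
      (Measure.pi fun _ : Fin n => PX).real s := fun s => by
    rw [← hmap]
    exact ENNReal.toReal_mono (measure_ne_top _ _) (Measure.le_map_apply hmeas.aemeasurable s)
  have hcover : (univ : Set (Fin n → ℝ × ℝ)) ⊆
      good ∪ (fun D a => (D a).1) ⁻¹' (bad ∪ {X | ¬ ∀ a, X a ∈ I01}) := by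
    intro D _
    by_cases h1 : (fun a => (D a).1) ∈ bad ∪ {X : Fin n → ℝ | ¬ ∀ a, X a ∈ I01}
    · exact Or.inr h1
    · refine Or.inl (h D ?_ fun hb => h1 (Or.inl hb))
      by_contra hc
      exact h1 (Or.inr hc)
  have h1 := (measureReal_mono (μ := dataLaw PX f₀ σ n) hcover (measure_ne_top _ _)).trans
    (measureReal_union_le _ _)
  rw [probReal_univ] at h1
  have h2 := (hle (bad ∪ {X | ¬ ∀ a, X a ∈ I01})).trans (measureReal_union_le _ _)
  have h3 : (Measure.pi fun _ : Fin n => PX).real {X | ¬ ∀ a, X a ∈ I01} = 0 := by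
    rw [measureReal_def, hout, ENNReal.toReal_zero]
  linarith

end DataLaw

/-! ### Constants and conclusion -/

/-- The exponent `n/(32 B²)` equals `(361/32) log n ≥ 11 log n`, where `361 = 19²`. The spare factor
`n ≥ 2` absorbs the 2 in front. -/
theorem two_mul_exp_le_inv_pow_ten {n : ℕ} (hn : 2 ≤ n) {B : ℝ}
    (hB : B = 1 / 19 * Real.sqrt (n / Real.log n)) :
    0 < B ∧ 2 * Real.exp (-(n * (1 / 2) ^ 2 / (8 * B ^ 2))) ≤ ((n : ℝ) ^ 10)⁻¹ := by
  have hn2 : (2 : ℝ) ≤ n := by exact_mod_cast hn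
  have hn0 : (0 : ℝ) < n := by linarith
  have hlog : 0 < Real.log n := Real.log_pos (by linarith)
  have hB2 : B ^ 2 = 1 / 361 * (n / Real.log n) := by
    rw [hB, mul_pow, Real.sq_sqrt (by positivity)]
    norm_num
  refine ⟨by rw [hB]; positivity, ?_⟩
  have e : (n : ℝ) * (1 / 2) ^ 2 / (8 * B ^ 2) = 361 / 32 * Real.log n := by
    rw [hB2]
    field_simp
    norm_num
  have h11 : Real.exp (-(n * (1 / 2) ^ 2 / (8 * B ^ 2))) ≤ ((n : ℝ) ^ 11)⁻¹ := by
    rw [e, ← Real.exp_log (pow_pos hn0 11), ← Real.exp_neg, Real.log_pow]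
    refine Real.exp_le_exp.2 ?_
    push_cast
    linarith
  calc _ ≤ 2 * ((n : ℝ) ^ 11)⁻¹ := by linarith
    _ ≤ n * ((n : ℝ) ^ 11)⁻¹ := by gcongr
    _ = _ := by field_simp

end PlugInGP

open PlugInGP SqSummable in
theorem lemma1
    (PX : Measure ℝ) [IsProbabilityMeasure PX]
    (hPX_supp : PX (PlugInGP.I01)ᶜ = 0) (hPX_ac : PX ≪ volume)
    (k : ℕ) (f₀ : ℝ → ℝ) (hf₀ : ContDiffOn ℝ k f₀ PlugInGP.I01)
    (σ : ℝ) (hσ : 0 < σ)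
    (K : ℝ → ℝ → ℝ) (hK : PlugInGP.IsC2k k K)
    (μ : ℕ → ℝ) (φ : ℕ → ℝ → ℝ) (hmercer : PlugInGP.IsMercerSystem PX K μ φ)
    (hA : PlugInGP.AssumptionA k φ)
    (lam : ℕ → ℝ) (hlam : ∀ n, 0 < lam n)
    (hkappa : (fun n : ℕ => PlugInGP.kappaSq μ φ (lam n) 0)
      =o[atTop] (fun n : ℕ => Real.sqrt ((n : ℝ) / Real.log (n : ℝ)))) :
    ∀ᶠ n : ℕ in atTop,
      1 - ((n : ℝ) ^ 10)⁻¹ ≤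
        (PlugInGP.dataLaw PX f₀ σ n).real
          {D : Fin n → ℝ × ℝ | ∀ x ∈ PlugInGP.I01,
            |PlugInGP.plugInCov k K σ (lam n) (fun i => (D i).1) x x| ≤
              2 * σ ^ 2 * PlugInGP.kappaSq μ φ (lam n) k / (n : ℝ)} := by
  have hK0 : ContinuousOn (fun p : ℝ × ℝ => K p.1 p.2) (I01 ×ˢ I01) := by
    simpa [mixedDeriv] using (hK 0 (Nat.zero_le k)).2.2
  obtain ⟨ψ, hψc, hψp, hval, hψK⟩ := hmercer.exists_featureMap hK0
  obtain ⟨g, hgg, hg⟩ := exists_featureMap_derivatives hK hψK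
    (hmercer.dense_span hPX_supp hψc hψp hval)
  have hg0 : ∀ x ∈ I01, ψ x = g 0 x := fun x hx => by
    refine ext_inner_left ℝ fun v => ?_
    rw [← hg v 0 (Nat.zero_le k) x hx, iteratedDerivWithin_zero]
  -- Of the little-o only `κ̃² ≤ (1/19)√(n/log n)` is used; this bound serves as the Hoeffding range
  -- `B`.
  filter_upwards [hkappa.def (show (0 : ℝ) < 1 / 19 by norm_num), eventually_ge_atTop 2] with n hn hn2
  obtain ⟨hB, hexp⟩ := two_mul_exp_le_inv_pow_ten hn2 rfl
  set B := 1 / 19 * Real.sqrt ((n : ℝ) / Real.log n)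
  have hl := hlam n
  have hwC : ∀ i, |(Real.sqrt (lam n + μ i))⁻¹| ≤ (Real.sqrt (lam n))⁻¹ := fun i => by
    rw [abs_of_nonneg (by positivity)]
    exact inv_anti₀ (Real.sqrt_pos.2 hl) (Real.sqrt_le_sqrt (by linarith [hmercer.pos i]))
  have hsC : ∀ i, |Real.sqrt (lam n + μ i)| ≤ Real.sqrt (lam n + μ 0) := fun i => by
    rw [abs_of_nonneg (Real.sqrt_nonneg _)]
    exact Real.sqrt_le_sqrt (by linarith [hmercer.antitone (Nat.zero_le i)])
  set Z : ℝ → SqSummable (ℕ × ℕ) := fun x => tensorSq (diagOp _ _ hwC (ψ x)) with hZ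
  have hZc : Continuous Z :=
    SqSummable.continuous_tensorSq.comp ((diagOp _ _ hwC).continuous.comp hψc)
  have hZB : ∀ x, ‖Z x‖ ≤ B := fun x => by
    obtain ⟨y, hy, he⟩ := hψp x
    rw [hZ]
    simp only [he, hg0 y hy, norm_tensorSq]
    refine (norm_diagOp_sq_le_kappaSq hK hmercer.pos hval hgg hg hl (fun _ => rfl) hwC
      (Nat.zero_le k) hy).trans ((le_abs_self _).trans (hn.trans_eq ?_))
    rw [Real.norm_eq_abs, abs_of_nonneg (Real.sqrt_nonneg _)]
  refine one_sub_le_dataLaw σ hPX_supp hf₀.continuousOn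
    ((measureReal_norm_sum_centered_ge_le PX hZc.stronglyMeasurable hZB hB n
      (show (0 : ℝ) < 1 / 2 by norm_num)).trans hexp) fun D hD hgood x hx => ?_
  exact abs_plugInCov_le hK hmercer.pos hψK hval hgg hg hl (fun _ => rfl) hwC hsC
    (hmercer.integral_tensorSq_apply hPX_supp hψc hψp hval hl (fun _ => rfl) hwC) σ (by omega) hD
    (not_le.1 hgood).le hx
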